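/- Let $T>0$, $A\in\mathbb R^{n\times n}$, $B\in\mathbb R^{n\times p}$, $C\in\mathbb R^{q\times n}$, $\Upsilon\in\mathbb R^{p\times q}$, $x_0\in\mathbb R^n$, and let $w:[0,T]\to\mathbb R^n$ be continuous. Consider the iteratively operated system $$\dot x_k(t)=Ax_k(t)+Bu_k(t)+w(t),\quad x_k(0)=x_0,\quad y_k(t)=Cx_k(t),\qquad t\in[0,T],\ k=0,1,2,\dots$$ Let $y_d\in C^1([0,T],\mathbb R^q)$ be any specified trajectory and $u_0\in C([0,T],\mathbb R^p)$ any initial input, and apply the D-type updating law $$u_{k+1}(t)=u_k(t)+\Upsilon\dot e_k(t),\qquad e_k=y_d-y_k,\qquad t\in[0,T],\ k=0,1,2,\dots$$ Call $y_d$ *trackable* if there is an input $u_d$ whose Laplace transform $U_d$ satisfies, on some right half plane, $$G_1(s)U_d(s)=Y_d(s)-G_2(s)D(s),\qquad G_1(s)=C(sI-A)^{-1}B,\quad G_2(s)=\big[C(sI-A)^{-1}\ \ C(sI-A)^{-1}\big],\quad D(s)=\begin{bmatrix}x_0\\ W(s)\end{bmatrix},$$ where $Y_d$ and $W$ are the Laplace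 transforms of some signals on $[0,\infty)$ that agree on $[0,T]$ with $y_d$ and $w$. Let $\rho$ denote the spectral radius. Suppose that either $q\ge p$ and $\rho(I-\Upsilon CB)<1$, or $q\le p$ and $\rho(I-CB\Upsilon)<1$. Then there are functions $u_\infty:[0,T]\to\mathbb R^p$ and $y_\infty:[0,T]\to\mathbb R^q$ such that $u_k\to u_\infty$ and $y_k\to y_\infty$ uniformly on $[0,T]$ as $k\to\infty$. Furthermore, perfect tracking, $\lim_{k\to\infty}y_k(t)=y_d(t)$ for all $t\in[0,T]$, together with continuity of $u_k$ on $[0,T]$ for every $k\ge 0$, holds if and only if $y_d$ is trackable. -/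

import Mathlib

open Set Filter Topology MeasureTheory

namespace ILC

noncomputable section

/-- The componentwise (one-sided) Laplace transform `∫₀^∞ e^{-st} f(t) dt` of a vector signal. -/
def laplace {n : ℕ} (f : ℝ → Fin n → ℝ) (s : ℂ) : Fin n → ℂ :=
  fun i => ∫ t in Ioi (0 : ℝ), Complex.exp (-s * (t : ℂ)) * ((f t i : ℝ) : ℂ)

/-- The Laplace integral of every component of `f` converges absolutely for `Re s > σ`. -/
def HasLaplace {n : ℕ} (σ : ℝ) (f : ℝ → Fin n → ℝ) : Prop :=
  ∀ s : ℂ, σ < s.re → ∀ i : Fin n,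
    IntegrableOn (fun t : ℝ => Complex.exp (-s * (t : ℂ)) * ((f t i : ℝ) : ℂ)) (Ioi (0 : ℝ))

/-- A real matrix or vector regarded as a complex one. -/
def cM {m n : ℕ} (M : Matrix (Fin m) (Fin n) ℝ) : Matrix (Fin m) (Fin n) ℂ :=
  M.map (fun r : ℝ => (r : ℂ))

/-- `C (sI - A)⁻¹`. -/
def outputResolvent {n q : ℕ} (A : Matrix (Fin n) (Fin n) ℝ) (C : Matrix (Fin q) (Fin n) ℝ)
    (s : ℂ) : Matrix (Fin q) (Fin n) ℂ :=
  cM C * (s • (1 : Matrix (Fin n) (Fin n) ℂ) - cM A)⁻¹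

/-- The transfer matrix `G₁(s) = C (sI - A)⁻¹ B` from the control input to the output. -/
def G₁ {n p q : ℕ} (A : Matrix (Fin n) (Fin n) ℝ) (B : Matrix (Fin n) (Fin p) ℝ)
    (C : Matrix (Fin q) (Fin n) ℝ) (s : ℂ) : Matrix (Fin q) (Fin p) ℂ :=
  outputResolvent A C s * cM B

/-- The transfer matrix `G₂(s) = [C (sI - A)⁻¹  C (sI - A)⁻¹]` from the additional inputs
(initial state and disturbance) to the output. -/
def G₂ {n q : ℕ} (A : Matrix (Fin n) (Fin n) ℝ) (C : Matrix (Fin q) (Fin n) ℝ)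
    (s : ℂ) : Matrix (Fin q) (Fin n ⊕ Fin n) ℂ :=
  Matrix.fromCols (outputResolvent A C s) (outputResolvent A C s)

/-- The transform `D(s) = [x₀; W(s)]` of the additional inputs. -/
def addInput {n : ℕ} (x₀ : Fin n → ℝ) (w : ℝ → Fin n → ℝ) (s : ℂ) : Fin n ⊕ Fin n → ℂ :=
  Sum.elim (fun i => ((x₀ i : ℝ) : ℂ)) (laplace w s)

/-- `yd` is trackable on `[0, T]`: some input `ud` satisfies
`G₁(s) Ud(s) = Yd(s) - G₂(s) D(s)`. Only the values of `yd` and `w` on `[0, T]` are given, so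
their Laplace transforms are those of signals on the half line that agree with them on `[0, T]`;
the equation is required on some right half plane on which all transforms exist. -/
def IsTrackable {n p q : ℕ} (T : ℝ) (A : Matrix (Fin n) (Fin n) ℝ)
    (B : Matrix (Fin n) (Fin p) ℝ) (C : Matrix (Fin q) (Fin n) ℝ) (x₀ : Fin n → ℝ)
    (w : ℝ → Fin n → ℝ) (yd : ℝ → Fin q → ℝ) : Prop :=
  ∃ (ud : ℝ → Fin p → ℝ) (y' : ℝ → Fin q → ℝ) (w' : ℝ → Fin n → ℝ) (σ : ℝ),
    EqOn y' yd (Icc 0 T) ∧ EqOn w' w (Icc 0 T) ∧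
    HasLaplace σ ud ∧ HasLaplace σ y' ∧ HasLaplace σ w' ∧
    ∀ s : ℂ, σ < s.re →
      (G₁ A B C s).mulVec (laplace ud s)
        = laplace y' s - (G₂ A C s).mulVec (addInput x₀ w' s)

/-- `x` is the state of `ẋ = A x + B u + w`, `x(0) = x₀`, on `[0, T]` (one-sided derivatives at
the end points). -/
def IsState {n p : ℕ} (T : ℝ) (A : Matrix (Fin n) (Fin n) ℝ) (B : Matrix (Fin n) (Fin p) ℝ)
    (x₀ : Fin n → ℝ) (w : ℝ → Fin n → ℝ) (u : ℝ → Fin p → ℝ) (x : ℝ → Fin n → ℝ) : Prop :=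
  x 0 = x₀ ∧ ∀ t ∈ Icc 0 T,
    HasDerivWithinAt x (A.mulVec (x t) + B.mulVec (u t) + w t) (Icc 0 T) t

/-- The output `y = C x`. -/
def output {n q : ℕ} (C : Matrix (Fin q) (Fin n) ℝ) (x : ℝ → Fin n → ℝ) : ℝ → Fin q → ℝ :=
  fun t => C.mulVec (x t)

/-- The D-type updating law `u_{k+1}(t) = u_k(t) + Υ ė_k(t)`, `t ∈ [0, T]`, with the tracking
error `e_k = yd - y_k`. -/
def IsDTypeUpdate {p q : ℕ} (T : ℝ) (Υ : Matrix (Fin p) (Fin q) ℝ) (yd : ℝ → Fin q → ℝ)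
    (u : ℕ → ℝ → Fin p → ℝ) (y : ℕ → ℝ → Fin q → ℝ) : Prop :=
  ∀ k : ℕ, ∀ t ∈ Icc 0 T,
    u (k + 1) t = u k t + Υ.mulVec (derivWithin (fun τ => yd τ - y k τ) (Icc 0 T) t)

/-- The spectral radius (largest modulus of a complex eigenvalue) of a real square matrix. -/
def specRad {n : ℕ} (M : Matrix (Fin n) (Fin n) ℝ) : ENNReal :=
  spectralRadius ℂ (cM M)

end

end ILC

/-!
The updating law turns the inputs into the iteration
`u (k+1) = (1 - Υ C B) u k - Υ C A x k + Υ (ẏd - C w)`, and the error derivatives into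
`ė (k+1) = (1 - C B Υ) ė k - C A (x (k+1) - x k)`. In both, the state enters only through a Volterra
operator, which is arbitrarily small in the norm `sup exp (-l t) ‖·‖` for large `l`. So the spectral
radius of the memoryless part decides: by Gelfand's formula the powers of that matrix decay
geometrically (`exists_norm_pow_le`), hence so do the increments of the iteration
(`exists_geometric_bound`), which gives uniform convergence of the inputs, the states and the
outputs.

If tracking is perfect, the uniform limit of the inputs is a continuous input with output `yd`. It
shows trackability: after time `T` the state is held constant by means of the disturbance, and
integration by parts gives the equation between the transforms (`IsState.isTrackable`).

Conversely, a trackable `yd` comes from an input that is only known to be locally integrable and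
to have a Laplace transform. The Laplace transform of `exp (t A)` is the resolvent, the transform
takes convolutions to products, and it is injective up to null sets (`ae_eq_of_laplace_eq`).
Therefore `yd = C ξ` on `[0, T]` for a continuous solution `ξ` of the integral equation of the
system (`IsTrackable.exists_state`). In particular `yd 0 = C x₀`, which suffices when
`ρ (1 - C B Υ) < 1`, since then the derivatives of the errors tend to zero uniformly. When
`ρ (1 - Υ C B) < 1`, the matrix `C B` has a left inverse, and solving `ẏd = C (A ξ + B u + w)` for
the input shows that it agrees almost everywhere with a continuous one
(`IsTrackable.exists_isState`). That input is a fixed point of the updating law, so the iteration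
converges to it.
-/

open Set Filter Topology MeasureTheory

namespace ILC

/-! ### Contraction in an exponentially weighted supremum norm -/

section Contraction

variable {E F : Type*} [NormedAddCommGroup E] [NormedSpace ℝ E]
  [NormedAddCommGroup F] [NormedSpace ℝ F]

/-- A Gronwall bound in an exponentially weighted supremum norm: for a large weight exponent `l`,
the solution is smaller than the forcing by a factor of order `1 / (l - a)`. -/
theorem norm_le_mul_exp_of_norm_deriv_le {T a b l m : ℝ} {z z' : ℝ → F}
    (hz : ∀ t ∈ Icc 0 T, HasDerivWithinAt z (z' t) (Icc 0 T) t) (h0 : ‖z 0‖ ≤ m)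
    (hz' : ∀ t ∈ Icc 0 T, ‖z' t‖ ≤ a * ‖z t‖ + b * Real.exp (l * t))
    (hm : b < (l - a) * m) : ∀ t ∈ Icc 0 T, ‖z t‖ ≤ m * Real.exp (l * t) := by
  have hB : ∀ t, HasDerivAt (fun t => m * Real.exp (l * t)) (m * (Real.exp (l * t) * l)) t := by
    intro t
    have := (((hasDerivAt_id t).const_mul l).exp).const_mul m
    simpa using this
  have key := image_norm_le_of_norm_deriv_right_lt_deriv_boundary (f := z) (f' := z') (a := 0)
    (b := T) (fun t ht => (hz t ht).continuousWithinAt)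
    (fun t ht => (hz t (Ico_subset_Icc_self ht)).mono_of_mem_nhdsWithin
      (mem_of_superset (Ico_mem_nhdsGE ht.2)
        (fun s hs => ⟨ht.1.trans hs.1, hs.2.le⟩)))
    (by simpa using h0) hB ?_
  · exact fun t ht => key ht
  · intro t ht hBt
    have h1 := hz' t (Ico_subset_Icc_self ht)
    rw [hBt] at h1
    have := mul_lt_mul_of_pos_right hm (Real.exp_pos (l * t))
    linarith

/-- The discrete variation of constants formula. -/
theorem eq_pow_apply_add_sum {M : E →L[ℝ] E} {v : ℕ → E} {e : ℕ → E}
    (h : ∀ k, v (k + 1) = M (v k) + e k) (k : ℕ) :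
    v k = (M ^ k) (v 0) + ∑ j ∈ Finset.range k, (M ^ (k - 1 - j)) (e j) := by
  induction k with
  | zero => simp
  | succ k ih =>
    rw [h, ih, Finset.sum_range_succ, map_add, map_sum, pow_succ', add_assoc]
    simp only [mul_apply_eq_comp, add_tsub_cancel_right, tsub_self, pow_zero,
      one_apply_eq_self]
    congr 2
    refine Finset.sum_congr rfl fun j hj => ?_
    rw [← mul_apply_eq_comp, ← pow_succ']
    congr 2
    have := Finset.mem_range.1 hj
    omega

/-- If the powers of `M` decay geometrically, then the iteration `d ↦ M d + N z`, where `z` is the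
response to `G d` of a linear system at rest, decays geometrically as well: for a large weight
`exp (-l t)` the Volterra part is a small perturbation of `M`. -/
theorem exists_geometric_bound {T c r D : ℝ} {M : E →L[ℝ] E} {N : F →L[ℝ] E} {A : F →L[ℝ] F}
    {G : E →L[ℝ] F} {d : ℕ → ℝ → E} {z : ℕ → ℝ → F} (hr0 : 0 ≤ r) (hr : r < 1)
    (hM : ∀ k : ℕ, ‖M ^ k‖ ≤ c * r ^ k) (hD : ∀ t ∈ Icc 0 T, ‖d 0 t‖ ≤ D)
    (hd : ∀ k, ∀ t ∈ Icc 0 T, d (k + 1) t = M (d k t) + N (z k t)) (hz0 : ∀ k, z k 0 = 0)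
    (hz : ∀ k, ∀ t ∈ Icc 0 T, HasDerivWithinAt (z k) (A (z k t) + G (d k t)) (Icc 0 T) t) :
    ∃ K ρ : ℝ, 0 ≤ ρ ∧ ρ < 1 ∧ ∀ k, ∀ t ∈ Icc 0 T, ‖d k t‖ ≤ K * ρ ^ k ∧ ‖z k t‖ ≤ K * ρ ^ k := by
  obtain ⟨c', hcc', hc'⟩ : ∃ c' : ℝ, c ≤ c' ∧ 1 ≤ c' := ⟨max c 1, le_max_left _ _, le_max_right _ _⟩
  obtain ⟨D', hDD', hD'⟩ : ∃ D' : ℝ, D ≤ D' ∧ 0 < D' :=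
    ⟨max D 1, le_max_left _ _, lt_of_lt_of_le one_pos (le_max_right _ _)⟩
  -- The weight is chosen so large that the Volterra part, of size `c' ‖N‖ (‖G‖ + 1) / L`, fits into
  -- the gap between `r` and the midpoint `ρ` of `r` and `1`.
  set ρ := (1 + r) / 2 with hρ
  have hρ0 : 0 < ρ := by rw [hρ]; linarith
  set L := 2 * c' * (‖N‖ + 1) * (‖G‖ + 1) / (1 - r) with hL
  have h1r : 0 < 1 - r := by linarith
  have hL0 : 0 < L := by positivity
  set l := ‖A‖ + L with hl
  set κ := (‖G‖ + 1) / L with hκ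
  have hκ0 : 0 < κ := by positivity
  have hη : c' * ‖N‖ * κ ≤ ρ - r := by
    have : c' * (‖N‖ + 1) * κ = ρ - r := by
      rw [hκ, hL, hρ]; field_simp; ring
    rw [← this]
    have : ‖N‖ ≤ ‖N‖ + 1 := by linarith
    gcongr
  -- A weighted bound on `d` yields one on `z` with a factor of order `1 / L`.
  have hzb : ∀ k R, 0 < R → (∀ t ∈ Icc 0 T, ‖d k t‖ ≤ R * Real.exp (l * t)) →
      ∀ t ∈ Icc 0 T, ‖z k t‖ ≤ κ * R * Real.exp (l * t) := by
    intro k R hR hb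
    refine norm_le_mul_exp_of_norm_deriv_le (a := ‖A‖) (b := ‖G‖ * R) (hz k) ?_ ?_ ?_
    · rw [hz0, norm_zero]; positivity
    · intro t ht
      refine (norm_add_le _ _).trans (add_le_add (A.le_opNorm _) ((G.le_opNorm _).trans ?_))
      rw [mul_assoc]
      exact mul_le_mul_of_nonneg_left (hb t ht) (norm_nonneg _)
    · have : (l - ‖A‖) * (κ * R) = (‖G‖ + 1) * R := by
        rw [hl, hκ]; field_simp; ring
      rw [this]; linarith
  have hdb : ∀ k, ∀ t ∈ Icc 0 T, ‖d k t‖ ≤ c' * D' * ρ ^ k * Real.exp (l * t) := by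
    intro k
    induction k using Nat.strong_induction_on with
    | _ k ih =>
      intro t ht
      have he : 1 ≤ Real.exp (l * t) :=
        Real.one_le_exp (mul_nonneg (by positivity) ht.1)
      have hMk : ∀ i, ‖M ^ i‖ ≤ c' * r ^ i := fun i =>
        (hM i).trans (mul_le_mul_of_nonneg_right hcc' (pow_nonneg hr0 _))
      rw [eq_pow_apply_add_sum (v := fun k => d k t) (e := fun k => N (z k t))
        (fun k => hd k t ht) k]
      have h1 : ‖(M ^ k) (d 0 t)‖ ≤ c' * D' * r ^ k * Real.exp (l * t) := by
        calc ‖(M ^ k) (d 0 t)‖ ≤ ‖M ^ k‖ * ‖d 0 t‖ := (M ^ k).le_opNorm _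
          _ ≤ (c' * r ^ k) * D' := by
            gcongr
            · exact hMk k
            · exact (hD t ht).trans hDD'
          _ = c' * D' * r ^ k * 1 := by ring
          _ ≤ _ := by gcongr
      have h2 : ∀ j ∈ Finset.range k, ‖(M ^ (k - 1 - j)) (N (z j t))‖ ≤
          c' * D' * Real.exp (l * t) * (ρ - r) * (ρ ^ j * r ^ (k - 1 - j)) := by
        intro j hj
        have hzj := hzb j (c' * D' * ρ ^ j) (by positivity) (ih j (Finset.mem_range.1 hj)) t ht
        calc ‖(M ^ (k - 1 - j)) (N (z j t))‖ ≤ ‖M ^ (k - 1 - j)‖ * (‖N‖ * ‖z j t‖) :=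
              ((M ^ (k - 1 - j)).le_opNorm _).trans
                (mul_le_mul_of_nonneg_left (N.le_opNorm _) (norm_nonneg _))
          _ ≤ (c' * r ^ (k - 1 - j)) * (‖N‖ * (κ * (c' * D' * ρ ^ j) * Real.exp (l * t))) := by
            gcongr
            exact hMk _
          _ = c' * D' * Real.exp (l * t) * (c' * ‖N‖ * κ) * (ρ ^ j * r ^ (k - 1 - j)) := by ring
          _ ≤ _ := by gcongr
      have hgeom := geom_sum₂_mul ρ r k
      calc _ ≤ c' * D' * r ^ k * Real.exp (l * t) + ∑ j ∈ Finset.range k,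
            c' * D' * Real.exp (l * t) * (ρ - r) * (ρ ^ j * r ^ (k - 1 - j)) :=
            (norm_add_le _ _).trans
              (add_le_add h1 ((norm_sum_le _ _).trans (Finset.sum_le_sum h2)))
        _ = c' * D' * Real.exp (l * t) * (r ^ k +
            (∑ j ∈ Finset.range k, ρ ^ j * r ^ (k - 1 - j)) * (ρ - r)) := by
            rw [← Finset.mul_sum]; ring
        _ = _ := by rw [hgeom]; ring
  refine ⟨(1 + κ) * (c' * D') * Real.exp (l * |T|), ρ, hρ0.le, by rw [hρ]; linarith,
    fun k t ht => ?_⟩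
  have hexp : Real.exp (l * t) ≤ Real.exp (l * |T|) := by
    have : t ≤ |T| := ht.2.trans (le_abs_self T)
    gcongr
  have h1 := hdb k t ht
  have h2 := hzb k (c' * D' * ρ ^ k) (by positivity) (hdb k) t ht
  have hp : 0 ≤ c' * D' * ρ ^ k := by positivity
  constructor
  · calc _ ≤ _ := h1
      _ ≤ (1 + κ) * (c' * D' * ρ ^ k) * Real.exp (l * |T|) :=
        mul_le_mul (le_mul_of_one_le_left hp (by linarith)) hexp (Real.exp_pos _).le
          (by positivity)
      _ = _ := by ring
  · calc _ ≤ _ := h2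
      _ ≤ (1 + κ) * (c' * D' * ρ ^ k) * Real.exp (l * |T|) :=
        mul_le_mul (mul_le_mul_of_nonneg_right (by linarith) hp) hexp (Real.exp_pos _).le
          (by positivity)
      _ = _ := by ring

end Contraction

theorem exists_tendstoUniformlyOn_of_geometric {E : Type*} [NormedAddCommGroup E]
    [CompleteSpace E] {S : Set ℝ} {f : ℕ → ℝ → E}
    {K ρ : ℝ} (hρ0 : 0 ≤ ρ) (hρ : ρ < 1) (hf : ∀ k, ∀ t ∈ S, ‖f (k + 1) t - f k t‖ ≤ K * ρ ^ k) :
    ∃ g : ℝ → E, TendstoUniformlyOn f g atTop S := by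
  have hd : ∀ t ∈ S, ∀ k, dist (f k t) (f (k + 1) t) ≤ K * ρ ^ k := fun t ht k => by
    rw [dist_comm, dist_eq_norm]; exact hf k t ht
  have hlim : ∀ t, ∃ a, t ∈ S → Tendsto (fun k => f k t) atTop (𝓝 a) := by
    intro t
    by_cases ht : t ∈ S
    · obtain ⟨a, ha⟩ := cauchySeq_tendsto_of_complete (cauchySeq_of_le_geometric ρ K hρ (hd t ht))
      exact ⟨a, fun _ => ha⟩
    · exact ⟨0, fun h => absurd h ht⟩
  choose g hg using hlim
  refine ⟨g, Metric.tendstoUniformlyOn_iff.2 fun ε hε => ?_⟩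
  have h0 : Tendsto (fun k : ℕ => K * ρ ^ k / (1 - ρ)) atTop (𝓝 0) := by
    simpa using ((tendsto_pow_atTop_nhds_zero_of_lt_one hρ0 hρ).const_mul K).div_const (1 - ρ)
  filter_upwards [h0.eventually_lt_const hε] with k hk t ht
  rw [dist_comm]
  exact (dist_le_of_le_geometric_of_tendsto ρ K hρ (hd t ht) (hg t ht) k).trans_lt hk

theorem tendsto_of_geometric_bound {E : Type*} [NormedAddCommGroup E] {v : ℕ → E} {a : E}
    {K ρ : ℝ} (hρ0 : 0 ≤ ρ) (hρ : ρ < 1)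
    (h : ∀ k, ‖v k - a‖ ≤ K * ρ ^ k) : Tendsto v atTop (𝓝 a) := by
  rw [tendsto_iff_norm_sub_tendsto_zero]
  refine squeeze_zero (fun _ => norm_nonneg _) h ?_
  simpa using (tendsto_pow_atTop_nhds_zero_of_lt_one hρ0 hρ).const_mul K

/-! ### Matrices as bounded operators -/

/-- Multiplication by a matrix as a bounded operator between the coordinate spaces (with the
supremum norm). -/
def mulVecL {𝕜 : Type*} [RCLike 𝕜] {m n : ℕ} (M : Matrix (Fin m) (Fin n) 𝕜) :
    (Fin n → 𝕜) →L[𝕜] (Fin m → 𝕜) :=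
  LinearMap.toContinuousLinearMap M.mulVecLin

@[simp]
theorem mulVecL_apply {𝕜 : Type*} [RCLike 𝕜] {m n : ℕ} (M : Matrix (Fin m) (Fin n) 𝕜)
    (v : Fin n → 𝕜) : mulVecL M v = M.mulVec v := rfl

section

attribute [local instance] Matrix.linftyOpNormedRing Matrix.linftyOpNormedAlgebra
  Matrix.linftyOpNormedAddCommGroup

theorem cM_mul {l m n : ℕ} (M : Matrix (Fin l) (Fin m) ℝ) (N : Matrix (Fin m) (Fin n) ℝ) :
    cM (M * N) = cM M * cM N := by
  exact Matrix.map_mul (f := Complex.ofRealHom) (L := M) (M := N)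

theorem cM_one {n : ℕ} : cM (1 : Matrix (Fin n) (Fin n) ℝ) = 1 := by
  simp [cM]

theorem cM_pow {n : ℕ} (M : Matrix (Fin n) (Fin n) ℝ) (k : ℕ) : cM (M ^ k) = cM M ^ k := by
  induction k with
  | zero => simp [cM_one]
  | succ k ih => rw [pow_succ, cM_mul, ih, pow_succ]

theorem mulVecL_pow {n : ℕ} (M : Matrix (Fin n) (Fin n) ℝ) (k : ℕ) :
    mulVecL M ^ k = mulVecL (M ^ k) := by
  induction k with
  | zero => ext; simp
  | succ k ih => ext v; simp [pow_succ, ih]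

/-- Passing to complex matrices, where Gelfand's formula holds, does not decrease the norm. -/
theorem norm_mulVecL_le_norm_cM {m n : ℕ} (M : Matrix (Fin m) (Fin n) ℝ) :
    ‖mulVecL M‖ ≤ ‖cM M‖ := by
  have hv : ∀ {k : ℕ} (v : Fin k → ℝ), ‖fun i => (v i : ℂ)‖ = ‖v‖ := fun v => by
    simp [Pi.norm_def]
  refine ContinuousLinearMap.opNorm_le_bound _ (norm_nonneg _) fun v => ?_
  have h := Matrix.linfty_opNorm_mulVec (cM M) (fun i => (v i : ℂ))
  rw [hv] at h
  convert! h using 1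
  rw [← hv]
  congr 1
  ext i
  simp [cM, Matrix.mulVec, dotProduct]

/-- The powers of a real matrix of spectral radius less than one decay geometrically. -/
theorem exists_norm_pow_le {n : ℕ} {M : Matrix (Fin n) (Fin n) ℝ} (hM : specRad M < 1) :
    ∃ c r : ℝ, 0 ≤ r ∧ r < 1 ∧ ∀ k : ℕ, ‖mulVecL M ^ k‖ ≤ c * r ^ k := by
  obtain ⟨r, hr, hr1⟩ := ENNReal.lt_iff_exists_nnreal_btwn.1 hM
  have hr1' : (r : ℝ) < 1 := by exact_mod_cast hr1
  have hr0 : (0 : ℝ) < r := by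
    have : (0 : ENNReal) < r := lt_of_le_of_lt bot_le hr
    exact_mod_cast this
  have hev := (spectrum.pow_nnnorm_pow_one_div_tendsto_nhds_spectralRadius
    (cM M)).eventually_lt_const hr
  obtain ⟨N, hN⟩ := eventually_atTop.1 hev
  have hbig : ∀ k, N + 1 ≤ k → ‖cM M ^ k‖ ≤ (r : ℝ) ^ k := by
    intro k hk
    have hk0 : (0 : ℝ) < k := by exact_mod_cast (by omega : 0 < k)
    have h1 := ENNReal.rpow_le_rpow (hN k (by omega)).le hk0.le
    rw [← ENNReal.rpow_mul, one_div_mul_cancel hk0.ne', ENNReal.rpow_one,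
      ENNReal.rpow_natCast] at h1
    have h2 : ‖cM M ^ k‖₊ ≤ r ^ k := by exact_mod_cast h1
    exact_mod_cast h2
  have hterm : ∀ k, 0 ≤ ‖cM M ^ k‖ / (r : ℝ) ^ k := fun k => by positivity
  refine ⟨1 + ∑ k ∈ Finset.range (N + 1), ‖cM M ^ k‖ / (r : ℝ) ^ k, r, hr0.le, hr1', fun k => ?_⟩
  rw [mulVecL_pow]
  refine (norm_mulVecL_le_norm_cM _).trans ?_
  rw [cM_pow, ← div_le_iff₀ (pow_pos hr0 k)]
  rcases le_or_gt (N + 1) k with hk | hk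
  · have h1 : ‖cM M ^ k‖ / (r : ℝ) ^ k ≤ 1 := (div_le_one (pow_pos hr0 k)).2 (hbig k hk)
    linarith [Finset.sum_nonneg fun k (_ : k ∈ Finset.range (N + 1)) => hterm k]
  · linarith [Finset.single_le_sum (fun k _ => hterm k) (Finset.mem_range.2 hk)]

end

/-! ### States as solutions of the integral equation -/

section State

variable {n p : ℕ} {T : ℝ} {A : Matrix (Fin n) (Fin n) ℝ} {B : Matrix (Fin n) (Fin p) ℝ}
  {x₀ : Fin n → ℝ} {w : ℝ → Fin n → ℝ} {u : ℝ → Fin p → ℝ} {x : ℝ → Fin n → ℝ}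

theorem continuousOn_mulVec {m k : ℕ} {S : Set ℝ} {f : ℝ → Fin k → ℝ} (hf : ContinuousOn f S)
    (M : Matrix (Fin m) (Fin k) ℝ) : ContinuousOn (fun t => M.mulVec (f t)) S :=
  (mulVecL M).continuous.comp_continuousOn hf

theorem IsState.continuousOn (hx : IsState T A B x₀ w u x) : ContinuousOn x (Icc 0 T) :=
  fun t ht => (hx.2 t ht).continuousWithinAt

theorem continuousOn_rhs (hw : ContinuousOn w (Icc 0 T)) (hu : ContinuousOn u (Icc 0 T))
    (hx : ContinuousOn x (Icc 0 T)) :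
    ContinuousOn (fun t => A.mulVec (x t) + B.mulVec (u t) + w t) (Icc 0 T) :=
  ((continuousOn_mulVec hx A).add (continuousOn_mulVec hu B)).add hw

theorem IsState.eq_add_integral (hw : ContinuousOn w (Icc 0 T)) (hu : ContinuousOn u (Icc 0 T))
    (hx : IsState T A B x₀ w u x) {t : ℝ} (ht : t ∈ Icc 0 T) :
    x t = x₀ + ∫ τ in 0..t, (A.mulVec (x τ) + B.mulVec (u τ) + w τ) := by
  have hsub : Icc 0 t ⊆ Icc 0 T := Icc_subset_Icc_right ht.2
  rw [intervalIntegral.integral_eq_sub_of_hasDerivAt_of_le (f := x) ht.1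
    (hx.continuousOn.mono hsub) (fun τ hτ => (hx.2 τ (hsub (Ioo_subset_Icc_self hτ))).hasDerivAt
      (Icc_mem_nhds hτ.1 (hτ.2.trans_le ht.2))) ?_, hx.1]
  · abel
  · refine ContinuousOn.intervalIntegrable ?_
    rw [uIcc_of_le ht.1]
    exact (continuousOn_rhs hw hu hx.continuousOn).mono hsub

theorem isState_of_eq_add_integral (hT : 0 ≤ T) (hw : ContinuousOn w (Icc 0 T))
    (hu : ContinuousOn u (Icc 0 T)) (hx : ContinuousOn x (Icc 0 T))
    (h : ∀ t ∈ Icc 0 T, x t = x₀ + ∫ τ in 0..t, (A.mulVec (x τ) + B.mulVec (u τ) + w τ)) :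
    IsState T A B x₀ w u x := by
  refine ⟨by simpa using h 0 ⟨le_rfl, hT⟩, fun t ht => ?_⟩
  set f : ℝ → Fin n → ℝ := fun τ => A.mulVec (x τ) + B.mulVec (u τ) + w τ with hf
  set g : ℝ → Fin n → ℝ := IccExtend hT ((Icc 0 T).domRestrict f) with hg
  have hgc : Continuous g :=
    (continuousOn_iff_continuous_domRestrict.1 (continuousOn_rhs hw hu hx)).Icc_extend'
  have hgf : ∀ τ ∈ Icc 0 T, g τ = f τ := fun τ hτ => by
    rw [hg, IccExtend_of_mem _ _ hτ]; rfl
  have hd : HasDerivAt (fun s => x₀ + ∫ τ in 0..s, g τ) (g t) t :=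
    (intervalIntegral.integral_hasDerivAt_right (hgc.intervalIntegrable _ _)
      hgc.aestronglyMeasurable.stronglyMeasurableAtFilter hgc.continuousAt).const_add x₀
  have hxg : ∀ s ∈ Icc 0 T, x s = x₀ + ∫ τ in 0..s, g τ := by
    intro s hs
    rw [h s hs]
    congr 1
    refine intervalIntegral.integral_congr fun τ hτ => ?_
    rw [uIcc_of_le hs.1] at hτ
    exact (hgf τ ⟨hτ.1, hτ.2.trans hs.2⟩).symm
  have := hd.hasDerivWithinAt.congr (s := Icc 0 T) hxg (hxg t ht)
  rwa [hgf t ht] at this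

/-- States converge to the state of the limit input. -/
theorem isState_of_tendstoUniformlyOn {u : ℕ → ℝ → Fin p → ℝ} {x : ℕ → ℝ → Fin n → ℝ}
    {u' : ℝ → Fin p → ℝ} {x' : ℝ → Fin n → ℝ} (hT : 0 ≤ T) (hw : ContinuousOn w (Icc 0 T))
    (huc : ∀ k, ContinuousOn (u k) (Icc 0 T)) (hx : ∀ k, IsState T A B x₀ w (u k) (x k))
    (hu : TendstoUniformlyOn u u' atTop (Icc 0 T))
    (hxu : TendstoUniformlyOn x x' atTop (Icc 0 T)) : IsState T A B x₀ w u' x' := by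
  have hu'c : ContinuousOn u' (Icc 0 T) := hu.continuousOn (Frequently.of_forall huc)
  have hx'c : ContinuousOn x' (Icc 0 T) :=
    hxu.continuousOn (Frequently.of_forall fun k => (hx k).continuousOn)
  refine isState_of_eq_add_integral hT hw hu'c hx'c fun t ht => ?_
  have hsub : uIcc 0 t ⊆ Icc 0 T := by
    rw [uIcc_of_le ht.1]; exact Icc_subset_Icc_right ht.2
  have hunif : TendstoUniformlyOn (fun k τ => A.mulVec (x k τ) + B.mulVec (u k τ) + w τ)
      (fun τ => A.mulVec (x' τ) + B.mulVec (u' τ) + w τ) atTop (Icc 0 T) := by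
    refine TendstoUniformlyOn.add (TendstoUniformlyOn.add ?_ ?_) ?_
    · exact (mulVecL A).uniformContinuous.comp_tendstoUniformlyOn hxu
    · exact (mulVecL B).uniformContinuous.comp_tendstoUniformlyOn hu
    · exact fun s hs => Eventually.of_forall fun _ _ _ => refl_mem_uniformity hs
  have hlim := (hunif.mono hsub).tendsto_intervalIntegral_of_continuousOn (μ := volume)
    (Eventually.of_forall fun k =>
      (continuousOn_rhs hw (huc k) (hx k).continuousOn).mono hsub)
  refine tendsto_nhds_unique (hxu.tendsto_at ht) ((hlim.const_add x₀).congr fun k => ?_)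
  exact ((hx k).eq_add_integral hw (huc k) ht).symm

end State

/-! ### The Laplace transform as a vector-valued integral -/

noncomputable section

/-- A real vector regarded as a complex one, as a bounded real-linear map. -/
def cV (n : ℕ) : (Fin n → ℝ) →L[ℝ] (Fin n → ℂ) :=
  ContinuousLinearMap.pi fun i => Complex.ofRealCLM.comp (ContinuousLinearMap.proj i)

@[simp]
theorem cV_apply {n : ℕ} (v : Fin n → ℝ) (i : Fin n) : cV n v i = (v i : ℂ) := rfl

theorem cV_mulVec {m n : ℕ} (M : Matrix (Fin m) (Fin n) ℝ) (v : Fin n → ℝ) :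
    cV m (M.mulVec v) = (cM M).mulVec (cV n v) := by
  ext i
  simp [cM, Matrix.mulVec, dotProduct]

/-- The integrand `exp (-s t) f t` of the Laplace transform of a signal with values in a complex
normed space. -/
def lapIntegrand {E : Type*} [NormedAddCommGroup E] [NormedSpace ℂ E] (s : ℂ) (f : ℝ → E) (t : ℝ) :
    E :=
  Complex.exp (-s * t) • f t

theorem continuousOn_lapIntegrand {n : ℕ} {S : Set ℝ} {f : ℝ → Fin n → ℝ}
    (hf : ContinuousOn f S) (s : ℂ) : ContinuousOn (lapIntegrand s fun t => cV n (f t)) S :=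
  ContinuousOn.smul (f := fun t : ℝ => Complex.exp (-s * t)) (by fun_prop)
    ((cV n).continuous.comp_continuousOn hf)

theorem hasLaplace_iff {n : ℕ} {σ : ℝ} {f : ℝ → Fin n → ℝ} :
    HasLaplace σ f ↔ ∀ s : ℂ, σ < s.re →
      IntegrableOn (lapIntegrand s fun t => cV n (f t)) (Ioi 0) :=
  forall₂_congr fun _ _ => integrable_pi_iff.symm

theorem HasLaplace.integrableOn {n : ℕ} {σ : ℝ} {f : ℝ → Fin n → ℝ} (hf : HasLaplace σ f)
    {s : ℂ} (hs : σ < s.re) : IntegrableOn (lapIntegrand s fun t => cV n (f t)) (Ioi 0) :=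
  hasLaplace_iff.1 hf s hs

theorem HasLaplace.laplace_eq {n : ℕ} {σ : ℝ} {f : ℝ → Fin n → ℝ} (hf : HasLaplace σ f)
    {s : ℂ} (hs : σ < s.re) :
    laplace f s = ∫ t in Ioi 0, lapIntegrand s (fun t => cV n (f t)) t := by
  ext i
  exact (eval_integral (f := lapIntegrand s fun t => cV n (f t)) (hf s hs) i).symm

/-- The equation defining trackability, solved for the transform of the output. -/
theorem transfer_eq_iff {n p q : ℕ} {A : Matrix (Fin n) (Fin n) ℝ} {B : Matrix (Fin n) (Fin p) ℝ}
    {C : Matrix (Fin q) (Fin n) ℝ} {x₀ : Fin n → ℝ} {w : ℝ → Fin n → ℝ} {s : ℂ} {U : Fin p → ℂ}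
    {Y : Fin q → ℂ} :
    (G₁ A B C s).mulVec U = Y - (G₂ A C s).mulVec (addInput x₀ w s) ↔
      Y = (outputResolvent A C s).mulVec ((cM B).mulVec U + laplace w s + cV n x₀) := by
  have h : (G₂ A C s).mulVec (addInput x₀ w s) =
      (outputResolvent A C s).mulVec (cV n x₀) + (outputResolvent A C s).mulVec (laplace w s) := by
    rw [G₂, addInput, Matrix.fromCols_mulVec]
    rfl
  rw [h, G₁, Matrix.mulVec_add, Matrix.mulVec_add, Matrix.mulVec_mulVec, eq_sub_iff_add_eq,
    eq_comm]
  refine Eq.congr_right ?_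
  abel

section

attribute [local instance] Matrix.linftyOpNormedRing Matrix.linftyOpNormedAlgebra

/-- To the right of a large abscissa `s - A` is invertible. -/
theorem exists_isUnit_smul_one_sub {n : ℕ} (A : Matrix (Fin n) (Fin n) ℂ) :
    ∃ σ : ℝ, ∀ s : ℂ, σ < s.re → IsUnit (s • (1 : Matrix (Fin n) (Fin n) ℂ) - A).det := by
  refine ⟨‖A‖ * ‖(1 : Matrix (Fin n) (Fin n) ℂ)‖, fun s hs => ?_⟩
  have : s ∈ resolventSet ℂ A :=
    spectrum.mem_resolventSet_of_norm_lt_mul (hs.trans_le (Complex.re_le_norm s))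
  rw [spectrum.mem_resolventSet_iff, Algebra.algebraMap_eq_smul_one] at this
  exact (Matrix.isUnit_iff_isUnit_det _).1 this

end

theorem outputResolvent_mulVec {n q : ℕ} {A : Matrix (Fin n) (Fin n) ℝ}
    {C : Matrix (Fin q) (Fin n) ℝ} {s : ℂ}
    (hs : IsUnit (s • (1 : Matrix (Fin n) (Fin n) ℂ) - cM A).det) {X V : Fin n → ℂ}
    (h : s • X - (cM A).mulVec X = V) :
    (outputResolvent A C s).mulVec V = (cM C).mulVec X := by
  have h' : (s • (1 : Matrix (Fin n) (Fin n) ℂ) - cM A).mulVec X = V := by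
    rw [Matrix.sub_mulVec, Matrix.smul_mulVec, Matrix.one_mulVec, h]
  rw [outputResolvent, ← h', ← Matrix.mulVec_mulVec, Matrix.mulVec_mulVec X _ _,
    Matrix.nonsing_inv_mul _ hs, Matrix.one_mulVec]

/-! ### Realizing an exact output by a signal on the half line -/

/-- The signal that is `a` up to time `T` and constantly `b` afterwards. -/
def extendConst {n : ℕ} (T : ℝ) (a : ℝ → Fin n → ℝ) (b : Fin n → ℝ) (t : ℝ) : Fin n → ℝ :=
  if t ≤ T then a t else b

theorem extendConst_eqOn {n : ℕ} {T : ℝ} {a : ℝ → Fin n → ℝ} {b : Fin n → ℝ} :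
    EqOn (extendConst T a b) a (Icc 0 T) := fun _ ht => if_pos ht.2

section ExtendConst

variable {n : ℕ} {T : ℝ} {a : ℝ → Fin n → ℝ} {b : Fin n → ℝ} {s : ℂ}

theorem integrableOn_extendConst_Ioc (ha : ContinuousOn a (Icc 0 T)) :
    IntegrableOn (lapIntegrand s fun t => cV n (extendConst T a b t)) (Ioc 0 T) := by
  have h : IntegrableOn (lapIntegrand s fun t => cV n (a t)) (Icc 0 T) :=
    (continuousOn_lapIntegrand ha s).integrableOn_Icc
  refine (h.mono_set Ioc_subset_Icc_self).congr_fun (fun t ht => ?_) measurableSet_Ioc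
  simp [lapIntegrand, extendConst, ht.2]

theorem lapIntegrand_extendConst_eqOn_Ioi :
    EqOn (fun t : ℝ => Complex.exp (-s * t) • cV n b)
      (lapIntegrand s fun t => cV n (extendConst T a b t)) (Ioi T) := fun t ht => by
  simp [lapIntegrand, extendConst, not_le.2 (mem_Ioi.1 ht)]

theorem integrableOn_extendConst_Ioi (hs : 0 < s.re) :
    IntegrableOn (lapIntegrand s fun t => cV n (extendConst T a b t)) (Ioi T) := by
  refine IntegrableOn.congr_fun ?_ lapIntegrand_extendConst_eqOn_Ioi measurableSet_Ioi
  exact Integrable.smul_const (integrableOn_exp_mul_complex_Ioi (by simpa using hs) T) _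

theorem hasLaplace_extendConst (hT : 0 ≤ T) (ha : ContinuousOn a (Icc 0 T)) :
    HasLaplace 0 (extendConst T a b) := by
  refine hasLaplace_iff.2 fun s hs => ?_
  rw [← Ioc_union_Ioi_eq_Ioi hT]
  exact (integrableOn_extendConst_Ioc ha).union (integrableOn_extendConst_Ioi hs)

theorem laplace_extendConst (hT : 0 ≤ T) (ha : ContinuousOn a (Icc 0 T)) (hs : 0 < s.re) :
    laplace (extendConst T a b) s =
      (∫ t in 0..T, lapIntegrand s (fun t => cV n (a t)) t) +
        (Complex.exp (-s * T) / s) • cV n b := by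
  rw [(hasLaplace_extendConst hT ha).laplace_eq hs, ← Ioc_union_Ioi_eq_Ioi hT,
    setIntegral_union (Ioc_disjoint_Ioi le_rfl) measurableSet_Ioi
      (integrableOn_extendConst_Ioc ha) (integrableOn_extendConst_Ioi hs),
    intervalIntegral.integral_of_le hT]
  congr 1
  · refine setIntegral_congr_fun measurableSet_Ioc fun t ht => ?_
    simp [lapIntegrand, extendConst, ht.2]
  · rw [← setIntegral_congr_fun measurableSet_Ioi lapIntegrand_extendConst_eqOn_Ioi,
      integral_smul_const, integral_exp_mul_complex_Ioi (by simpa using hs), neg_div_neg_eq]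

end ExtendConst

theorem HasLaplace.laplace_mulVec {m n : ℕ} {σ : ℝ} {f : ℝ → Fin n → ℝ} (hf : HasLaplace σ f)
    (M : Matrix (Fin m) (Fin n) ℝ) :
    HasLaplace σ (fun t => M.mulVec (f t)) ∧
      ∀ s : ℂ, σ < s.re → laplace (fun t => M.mulVec (f t)) s = (cM M).mulVec (laplace f s) := by
  have h : ∀ s, (lapIntegrand s fun t => cV m (M.mulVec (f t))) =
      fun t => mulVecL (cM M) (lapIntegrand s (fun t => cV n (f t)) t) := fun s => by
    ext1 t
    rw [lapIntegrand, cV_mulVec, lapIntegrand, map_smul, mulVecL_apply]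
  have h1 : HasLaplace σ (fun t => M.mulVec (f t)) := by
    refine hasLaplace_iff.2 fun s hs => ?_
    rw [h]
    exact (mulVecL (cM M)).integrable_comp (hf.integrableOn hs)
  refine ⟨h1, fun s hs => ?_⟩
  rw [h1.laplace_eq hs, h, (mulVecL (cM M)).integral_comp_comm (hf.integrableOn hs),
    hf.laplace_eq hs, mulVecL_apply]

/-- An output that is produced by a continuous input is trackable: after time `T` the state is
frozen by switching the input off and compensating the drift by the disturbance. -/
theorem IsState.isTrackable {n p q : ℕ} {T : ℝ} {A : Matrix (Fin n) (Fin n) ℝ}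
    {B : Matrix (Fin n) (Fin p) ℝ} {C : Matrix (Fin q) (Fin n) ℝ} {x₀ : Fin n → ℝ}
    {w : ℝ → Fin n → ℝ} {u : ℝ → Fin p → ℝ} {x : ℝ → Fin n → ℝ} {yd : ℝ → Fin q → ℝ}
    (hx : IsState T A B x₀ w u x) (hT : 0 ≤ T) (hw : ContinuousOn w (Icc 0 T))
    (hu : ContinuousOn u (Icc 0 T)) (hy : ∀ t ∈ Icc 0 T, C.mulVec (x t) = yd t) :
    IsTrackable T A B C x₀ w yd := by
  obtain ⟨σ, hσ⟩ := exists_isUnit_smul_one_sub (cM A)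
  have hxc := hx.continuousOn
  have hX := hasLaplace_extendConst (b := x T) hT hxc
  have hU := hasLaplace_extendConst (b := 0) hT hu
  have hW := hasLaplace_extendConst (b := -A.mulVec (x T)) hT hw
  have mono : ∀ {k : ℕ} {f : ℝ → Fin k → ℝ}, HasLaplace 0 f → HasLaplace (max σ 0) f :=
    fun hf s hs => hf s ((le_max_right _ _).trans_lt hs)
  refine ⟨extendConst T u 0, fun t => C.mulVec (extendConst T x (x T) t),
    extendConst T w (-A.mulVec (x T)), max σ 0, fun t ht => ?_, extendConst_eqOn,
    mono hU, mono (hX.laplace_mulVec C).1, mono hW, fun s hs => ?_⟩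
  · simp only [extendConst_eqOn ht, hy t ht]
  have hs0 : 0 < s.re := (le_max_right _ _).trans_lt hs
  have hsne : s ≠ 0 := fun h => by simp [h] at hs0
  rw [transfer_eq_iff, (hX.laplace_mulVec C).2 s hs0]
  refine (outputResolvent_mulVec (hσ s ((le_max_left _ _).trans_lt hs)) ?_).symm
  rw [laplace_extendConst hT hxc hs0, laplace_extendConst hT hu hs0,
    laplace_extendConst hT hw hs0]
  have hint : ∀ {k : ℕ} {f : ℝ → Fin k → ℝ}, ContinuousOn f (Icc 0 T) →
      IntervalIntegrable (lapIntegrand s fun t => cV k (f t)) volume 0 T := by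
    intro k f hf
    refine ContinuousOn.intervalIntegrable ?_
    rw [uIcc_of_le hT]
    exact continuousOn_lapIntegrand hf s
  have hcomp : ∀ {k : ℕ} (M : Matrix (Fin n) (Fin k) ℝ) {f : ℝ → Fin k → ℂ},
      IntervalIntegrable f volume 0 T →
      IntervalIntegrable (fun t => mulVecL (cM M) (f t)) volume 0 T := fun M _ hf =>
    ⟨(mulVecL (cM M)).integrable_comp hf.1, (mulVecL (cM M)).integrable_comp hf.2⟩
  have hsx : IntervalIntegrable (fun t => s • lapIntegrand s (fun t => cV n (x t)) t) volume 0 T :=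
    (hint hxc).smul s
  -- Integration by parts on `[0, T]`.
  have hparts : (∫ t in 0..T, lapIntegrand s (fun t =>
        cV n (A.mulVec (x t) + B.mulVec (u t) + w t)) t) -
      s • ∫ t in 0..T, lapIntegrand s (fun t => cV n (x t)) t =
      Complex.exp (-s * T) • cV n (x T) - cV n x₀ := by
    have hc : ContinuousOn (lapIntegrand s fun t => cV n (x t)) (Icc 0 T) :=
      continuousOn_lapIntegrand hxc s
    have := intervalIntegral.integral_eq_sub_of_hasDerivAt_of_le
      (f := lapIntegrand s fun t => cV n (x t))
      (f' := fun t => lapIntegrand s (fun t =>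
        cV n (A.mulVec (x t) + B.mulVec (u t) + w t)) t -
          s • lapIntegrand s (fun t => cV n (x t)) t) hT hc ?_ ?_
    · rw [intervalIntegral.integral_sub (hint (continuousOn_rhs hw hu hxc))
        hsx, intervalIntegral.integral_smul] at this
      rw [this]
      simp [lapIntegrand, hx.1]
    · intro t ht
      have h1 : HasDerivAt (fun t => cV n (x t))
          (cV n (A.mulVec (x t) + B.mulVec (u t) + w t)) t :=
        (cV n).hasFDerivAt.comp_hasDerivAt t
          ((hx.2 t (Ioo_subset_Icc_self ht)).hasDerivAt (Icc_mem_nhds ht.1 ht.2))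
      have h2 : HasDerivAt (fun t : ℝ => Complex.exp (-s * t)) (Complex.exp (-s * t) * -s) t := by
        simpa using ((Complex.ofRealCLM.hasDerivAt (x := t)).const_mul (-s)).cexp
      convert! h2.smul h1 using 1
      simp [lapIntegrand, smul_smul, sub_eq_add_neg, mul_comm]
    · exact (hint (continuousOn_rhs hw hu hxc)).sub hsx
  have hsplit : (∫ t in 0..T, lapIntegrand s (fun t =>
        cV n (A.mulVec (x t) + B.mulVec (u t) + w t)) t) =
      (cM A).mulVec (∫ t in 0..T, lapIntegrand s (fun t => cV n (x t)) t) +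
      (cM B).mulVec (∫ t in 0..T, lapIntegrand s (fun t => cV p (u t)) t) +
      ∫ t in 0..T, lapIntegrand s (fun t => cV n (w t)) t := by
    rw [← mulVecL_apply, ← mulVecL_apply,
      ← ContinuousLinearMap.intervalIntegral_comp_comm _ (hint hxc),
      ← ContinuousLinearMap.intervalIntegral_comp_comm _ (hint hu),
      ← intervalIntegral.integral_add, ← intervalIntegral.integral_add]
    · congr 1
      ext1 t
      simp only [lapIntegrand, map_add, cV_mulVec, map_smul, mulVecL_apply, smul_add]
    · exact (hcomp A (hint hxc)).add
        (hcomp B (hint hu))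
    · exact hint hw
    · exact hcomp A (hint hxc)
    · exact hcomp B (hint hu)
  have hcancel : s • (Complex.exp (-s * T) / s) • cV n (x T) =
      Complex.exp (-s * T) • cV n (x T) := by
    rw [smul_smul, mul_div_cancel₀ _ hsne]
  rw [smul_add, hcancel, Matrix.mulVec_add, Matrix.mulVec_smul, map_zero, smul_zero, add_zero,
    map_neg, cV_mulVec, smul_neg]
  linear_combination (exp := 1) hsplit - hparts

end

/-! ### Uniqueness of the Laplace transform -/

/-- A real integrable function with vanishing Fourier transform is zero, because finite measures are
determined by their characteristic functions. -/
theorem ae_eq_zero_of_integral_char_eq_zero_real {μ : Measure ℝ} {f : ℝ → ℝ}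
    (hf : Integrable f μ) (h : ∀ a : ℝ, ∫ t, Complex.exp (a * t * Complex.I) * (f t : ℂ) ∂μ = 0) :
    f =ᵐ[μ] 0 := by
  have h1 := isFiniteMeasure_withDensity_ofReal hf.2
  have h2 := isFiniteMeasure_withDensity_ofReal hf.neg.2
  have hm : AEMeasurable f μ := hf.aemeasurable
  have hchar : ∀ (g : ℝ → ℝ), AEMeasurable g μ → ∀ a : ℝ,
      charFun (μ.withDensity fun x => ENNReal.ofReal (g x)) a =
        ∫ t, Complex.exp (a * t * Complex.I) * ((max (g t) 0 : ℝ) : ℂ) ∂μ := by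
    intro g hg a
    rw [charFun_apply_real, integral_withDensity_eq_integral_toReal_smul₀ hg.ennreal_ofReal
      (Eventually.of_forall fun _ => ENNReal.ofReal_lt_top)]
    refine integral_congr_ae (Eventually.of_forall fun t => ?_)
    simp only [ENNReal.toReal_ofReal', Complex.real_smul]
    ring
  have hint : ∀ (g : ℝ → ℝ), Integrable g μ → ∀ a : ℝ,
      Integrable (fun t : ℝ => Complex.exp (a * t * Complex.I) * (g t : ℂ)) μ := by
    intro g hg a
    refine hg.ofReal.bdd_mul (c := 1) (Continuous.aestronglyMeasurable (by fun_prop))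
      (Eventually.of_forall fun t => ?_)
    rw [← Complex.ofReal_mul, Complex.norm_exp_ofReal_mul_I]
  -- The positive and the negative part of `f` are densities with the same characteristic function.
  have key : μ.withDensity (fun x => ENNReal.ofReal (f x)) =
      μ.withDensity (fun x => ENNReal.ofReal (-f x)) := by
    refine Measure.ext_of_charFun (funext fun a => ?_)
    rw [hchar f hm, hchar (fun t => -f t) hm.neg, ← sub_eq_zero, ← integral_sub, ← h a]
    · refine integral_congr_ae (Eventually.of_forall fun t => ?_)
      simp only
      rw [← mul_sub, ← Complex.ofReal_sub]
      congr 2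
      rcases le_total (f t) 0 with h | h <;> simp [h]
    · exact hint _ hf.pos_part a
    · exact hint _ hf.neg_part a
  have hfin : ∫⁻ x, ENNReal.ofReal (f x) ∂μ ≠ ⊤ := hf.lintegral_lt_top.ne
  filter_upwards [(withDensity_eq_iff hm.ennreal_ofReal hm.neg.ennreal_ofReal hfin).1 key] with t ht
  have := congrArg ENNReal.toReal ht
  simp only [ENNReal.toReal_ofReal', Pi.neg_apply] at this
  rcases le_total (f t) 0 with h | h
  · rw [max_eq_right h, max_eq_left (neg_nonneg.2 h)] at this
    simpa using this.symm
  · rw [max_eq_left h, max_eq_right (neg_nonpos.2 h)] at this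
    exact this

theorem ae_eq_zero_of_integral_char_eq_zero {μ : Measure ℝ} {f : ℝ → ℂ} (hf : Integrable f μ)
    (h : ∀ a : ℝ, ∫ t, Complex.exp (a * t * Complex.I) * f t ∂μ = 0) : f =ᵐ[μ] 0 := by
  have hint : ∀ (g : ℝ → ℂ), Integrable g μ → ∀ a : ℝ,
      Integrable (fun t : ℝ => Complex.exp (a * t * Complex.I) * g t) μ := by
    intro g hg a
    refine hg.bdd_mul (c := 1) (Continuous.aestronglyMeasurable (by fun_prop))
      (Eventually.of_forall fun t => ?_)
    rw [← Complex.ofReal_mul, Complex.norm_exp_ofReal_mul_I]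
  have hconj : ∀ a : ℝ, ∫ t, Complex.exp (a * t * Complex.I) * (starRingEnd ℂ) (f t) ∂μ = 0 := by
    intro a
    have h1 := congrArg (starRingEnd ℂ) (h (-a))
    rw [← integral_conj, map_zero] at h1
    rw [← h1]
    refine integral_congr_ae (Eventually.of_forall fun t => ?_)
    simp [← Complex.exp_conj]
  have hfc : Integrable (fun t => (starRingEnd ℂ) (f t)) μ :=
    (Complex.conjCLE.toContinuousLinearMap).integrable_comp hf
  have hre : (fun t => (f t).re) =ᵐ[μ] 0 := by
    refine ae_eq_zero_of_integral_char_eq_zero_real hf.re fun a => ?_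
    have : ∀ t : ℝ, Complex.exp (a * t * Complex.I) * ((f t).re : ℂ) =
        (1 / 2 : ℂ) * (Complex.exp (a * t * Complex.I) * f t +
          Complex.exp (a * t * Complex.I) * (starRingEnd ℂ) (f t)) := fun t => by
      rw [Complex.re_eq_add_conj]; ring
    simp_rw [this]
    rw [integral_const_mul, integral_add (hint _ hf a) (hint _ hfc a), h, hconj]
    simp
  have him : (fun t => (f t).im) =ᵐ[μ] 0 := by
    refine ae_eq_zero_of_integral_char_eq_zero_real hf.im fun a => ?_
    have : ∀ t : ℝ, Complex.exp (a * t * Complex.I) * ((f t).im : ℂ) =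
        (1 / (2 * Complex.I) : ℂ) * (Complex.exp (a * t * Complex.I) * f t -
          Complex.exp (a * t * Complex.I) * (starRingEnd ℂ) (f t)) := fun t => by
      rw [Complex.im_eq_sub_conj]; ring
    simp_rw [this]
    rw [integral_const_mul, integral_sub (hint _ hf a) (hint _ hfc a), h, hconj]
    simp
  filter_upwards [hre, him] with t h1 h2
  exact Complex.ext h1 h2

/-- A signal is determined by its Laplace transform on a half plane. On a vertical line the
transform is the Fourier transform of an integrable function. -/
theorem ae_eq_of_laplace_eq {n : ℕ} {σ : ℝ} {f g : ℝ → Fin n → ℂ}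
    (hf : ∀ s : ℂ, σ < s.re → IntegrableOn (lapIntegrand s f) (Ioi 0))
    (hg : ∀ s : ℂ, σ < s.re → IntegrableOn (lapIntegrand s g) (Ioi 0))
    (h : ∀ s : ℂ, σ < s.re →
      ∫ t in Ioi 0, lapIntegrand s f t = ∫ t in Ioi 0, lapIntegrand s g t) :
    f =ᵐ[volume.restrict (Ioi 0)] g := by
  have hσ : σ < ((σ + 1 : ℝ) : ℂ).re := by simp
  have hi : ∀ i, (fun t => lapIntegrand ((σ + 1 : ℝ) : ℂ) f t i -
      lapIntegrand ((σ + 1 : ℝ) : ℂ) g t i) =ᵐ[volume.restrict (Ioi 0)] 0 := by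
    intro i
    refine ae_eq_zero_of_integral_char_eq_zero
      (((hf _ hσ).eval i).sub ((hg _ hσ).eval i)) fun a => ?_
    set s : ℂ := ((σ + 1 : ℝ) : ℂ) - a * Complex.I with hs
    have hsre : σ < s.re := by simp [hs]
    have h1 := congrFun (h s hsre) i
    rw [eval_integral (fun i => (hf s hsre).eval i),
      eval_integral (fun i => (hg s hsre).eval i), ← sub_eq_zero,
      ← integral_sub ((hf s hsre).eval i) ((hg s hsre).eval i)] at h1
    rw [← h1]
    refine integral_congr_ae (Eventually.of_forall fun t => ?_)
    have : Complex.exp (-s * t) =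
        Complex.exp (a * t * Complex.I) * Complex.exp (-((σ + 1 : ℝ) : ℂ) * t) := by
      rw [← Complex.exp_add, hs]; ring_nf
    simp only [lapIntegrand, Pi.smul_apply, smul_eq_mul, this]
    ring
  filter_upwards [ae_all_iff.2 hi] with t ht
  ext i
  have h1 := ht i
  simp only [lapIntegrand, Pi.smul_apply, smul_eq_mul, ← mul_sub, Pi.zero_apply, mul_eq_zero,
    Complex.exp_ne_zero, false_or] at h1
  exact sub_eq_zero.1 h1

/-! ### The Laplace transform of a response -/

/-- The Laplace transform turns the response `∫₀ᵗ L (K (t - τ)) (h τ) dτ` into a product. -/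
theorem laplace_response {E F G : Type*} [NormedAddCommGroup E] [NormedSpace ℂ E]
    [CompleteSpace E] [NormedAddCommGroup F] [NormedSpace ℂ F] [CompleteSpace F]
    [NormedAddCommGroup G] [NormedSpace ℂ G] [CompleteSpace G] (L : F →L[ℂ] E →L[ℂ] G) {s : ℂ}
    {K : ℝ → F} {h : ℝ → E}
    (hK : IntegrableOn (lapIntegrand s K) (Ioi 0))
    (hh : IntegrableOn (lapIntegrand s h) (Ioi 0)) :
    IntegrableOn (lapIntegrand s fun t => ∫ τ in 0..t, L (K (t - τ)) (h τ)) (Ioi 0) ∧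
      ∫ t in Ioi 0, lapIntegrand s (fun t => ∫ τ in 0..t, L (K (t - τ)) (h τ)) t =
        L (∫ t in Ioi 0, lapIntegrand s K t) (∫ t in Ioi 0, lapIntegrand s h t) := by
  set k : ℝ → F :=
    (Ioi 0).indicator (lapIntegrand s K) with hk
  set g : ℝ → E := (Ioi 0).indicator (lapIntegrand s h) with hg
  have hki : Integrable k := (integrable_indicator_iff measurableSet_Ioi).2 hK
  have hgi : Integrable g := hh.integrable_indicator measurableSet_Ioi
  have hconv : convolution g k L.flip volume = (Ioi 0).indicator
      (lapIntegrand s fun t => ∫ τ in 0..t, L (K (t - τ)) (h τ)) := by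
    ext1 t
    rw [convolution_def]
    have hpt : (fun τ => L.flip (g τ) (k (t - τ))) = (Ioo 0 t).indicator
        (fun τ => Complex.exp (-s * t) • L (K (t - τ)) (h τ)) := by
      ext1 τ
      by_cases h1 : 0 < τ
      · by_cases h2 : τ < t
        · rw [indicator_of_mem (show τ ∈ Ioo 0 t from ⟨h1, h2⟩), hg, hk,
            indicator_of_mem (mem_Ioi.2 h1), indicator_of_mem (mem_Ioi.2 (sub_pos.2 h2))]
          simp only [ContinuousLinearMap.flip_apply, lapIntegrand,
            _root_.smul_apply, map_smul, smul_smul, ← Complex.exp_add]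
          congr 2
          push_cast; ring
        · rw [indicator_of_notMem (fun hm => h2 hm.2), hk,
            indicator_of_notMem (by simpa using h2), map_zero]
      · rw [indicator_of_notMem (fun hm => h1 hm.1), hg, indicator_of_notMem (by simpa using h1),
          map_zero, _root_.zero_apply]
    rw [hpt, integral_indicator measurableSet_Ioo, integral_smul]
    by_cases ht : 0 < t
    · rw [indicator_of_mem (mem_Ioi.2 ht), lapIntegrand, intervalIntegral.integral_of_le ht.le,
        integral_Ioc_eq_integral_Ioo]
    · rw [indicator_of_notMem (by simpa using ht), Ioo_eq_empty (by simpa using ht)]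
      simp
  have hci := hgi.integrable_convolution L.flip hki
  have hcv := integral_convolution (L := L.flip) hgi hki
  rw [hconv] at hci hcv
  refine ⟨(integrable_indicator_iff measurableSet_Ioi).1 hci, ?_⟩
  rwa [integral_indicator measurableSet_Ioi, hg, hk, integral_indicator measurableSet_Ioi,
    integral_indicator measurableSet_Ioi] at hcv

section Response

variable {E : Type*} [NormedAddCommGroup E] [NormedSpace ℂ E] [CompleteSpace E]

/-- The Laplace transform of `exp (t a)` is the resolvent of `a`. -/
theorem laplace_exp (a : E →L[ℂ] E) {s : ℂ} (hs : ‖a‖ + 1 < s.re) :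
    IntegrableOn (lapIntegrand s fun t : ℝ => NormedSpace.exp (t • a)) (Ioi 0) ∧
      s • (∫ t in Ioi 0, lapIntegrand s (fun t : ℝ => NormedSpace.exp (t • a)) t) -
        a * (∫ t in Ioi 0, lapIntegrand s (fun t : ℝ => NormedSpace.exp (t • a)) t) = 1 := by
  have hderiv : ∀ t : ℝ, HasDerivAt (fun t : ℝ => NormedSpace.exp (t • a))
      (a * NormedSpace.exp (t • a)) t := fun t => hasDerivAt_exp_smul_const' a t
  have hcont : Continuous fun t : ℝ => NormedSpace.exp (t • a) :=
    continuous_iff_continuousAt.2 fun t => (hderiv t).continuousAt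
  have hbound : ∀ t : ℝ, 0 ≤ t → ‖NormedSpace.exp (t • a)‖ ≤
      (‖(1 : E →L[ℂ] E)‖ + 1) * Real.exp ((‖a‖ + 1) * t) := by
    intro t ht
    refine norm_le_mul_exp_of_norm_deriv_le (T := t) (a := ‖a‖) (b := 0)
      (z := fun t : ℝ => NormedSpace.exp (t • a)) (fun τ _ => (hderiv τ).hasDerivWithinAt)
      (by simp) (fun τ _ => ?_) ?_ t ⟨ht, le_rfl⟩
    · simpa using norm_mul_le a (NormedSpace.exp (τ • a))
    · have := norm_nonneg (1 : E →L[ℂ] E)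
      linarith
  set R : ℝ → E →L[ℂ] E := lapIntegrand s (fun t : ℝ => NormedSpace.exp (t • a)) with hR
  have hRcont : Continuous R := by
    have : Continuous fun t : ℝ => Complex.exp (-s * t) := by fun_prop
    exact this.smul hcont
  have hRb : ∀ t ∈ Ioi (0 : ℝ), ‖R t‖ ≤
      (‖(1 : E →L[ℂ] E)‖ + 1) * Real.exp ((‖a‖ + 1 - s.re) * t) := by
    intro t ht
    rw [hR, lapIntegrand, norm_smul, Complex.norm_exp]
    calc _ ≤ Real.exp (-s * t).re * ((‖(1 : E →L[ℂ] E)‖ + 1) * Real.exp ((‖a‖ + 1) * t)) :=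
          mul_le_mul_of_nonneg_left (hbound t (mem_Ioi.1 ht).le) (Real.exp_pos _).le
      _ = _ := by
          rw [mul_left_comm, ← Real.exp_add]
          congr 2
          simp
          ring
  have hneg : ‖a‖ + 1 - s.re < 0 := by linarith
  have hRint : IntegrableOn R (Ioi 0) := by
    refine Integrable.mono' ((integrableOn_exp_mul_Ioi hneg 0).const_mul (‖(1 : E →L[ℂ] E)‖ + 1))
      hRcont.aestronglyMeasurable ?_
    filter_upwards [ae_restrict_mem measurableSet_Ioi] with t ht using hRb t ht
  refine ⟨hRint, ?_⟩
  have hRderiv : ∀ t : ℝ, HasDerivAt R (a * R t - s • R t) t := by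
    intro t
    have h2 : HasDerivAt (fun t : ℝ => Complex.exp (-s * t)) (Complex.exp (-s * t) * -s) t := by
      simpa using ((Complex.ofRealCLM.hasDerivAt (x := t)).const_mul (-s)).cexp
    convert! h2.smul (hderiv t) using 1
    simp only [hR, lapIntegrand, mul_smul_comm, smul_smul, sub_eq_add_neg, mul_neg, neg_smul,
      neg_mul, mul_comm s]
  have htend : Tendsto R atTop (𝓝 0) := by
    refine squeeze_zero_norm' (eventually_gt_atTop 0 |>.mono hRb) ?_
    have : Tendsto (fun t : ℝ => (‖a‖ + 1 - s.re) * t) atTop atBot :=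
      tendsto_id.const_mul_atTop_of_neg hneg
    simpa using (Real.tendsto_exp_atBot.comp this).const_mul (‖(1 : E →L[ℂ] E)‖ + 1)
  have haR : IntegrableOn (fun t => a * R t) (Ioi 0) := hRint.const_mul' a
  have hsR : IntegrableOn (fun t => s • R t) (Ioi 0) := hRint.smul s
  have := integral_Ioi_of_hasDerivAt_of_tendsto' (fun t _ => hRderiv t) (haR.sub hsR) htend
  rw [integral_sub haR hsR, integral_smul, integral_const_mul_of_integrable hRint] at this
  rw [← neg_sub, this]
  simp [hR, lapIntegrand]

end Response

/-! ### Solutions of the state equation for integrable inputs -/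

noncomputable section

section

variable {E : Type*} [NormedAddCommGroup E] [NormedSpace ℂ E]

theorem integrableOn_Icc_of_lapIntegrand {s : ℂ} {f : ℝ → E} (T : ℝ)
    (hf : IntegrableOn (lapIntegrand s f) (Ioi 0)) : IntegrableOn f (Icc 0 T) := by
  have h1 : IntegrableOn (lapIntegrand s f) (Icc 0 T) :=
    (integrableOn_Icc_iff_integrableOn_Ioc (by finiteness)).2 (hf.mono_set Ioc_subset_Ioi_self)
  have h2 := h1.continuousOn_smul (f := fun t : ℝ => Complex.exp (s * t)) (by fun_prop)
    isCompact_Icc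
  refine h2.congr_fun (fun t _ => ?_) measurableSet_Icc
  simp [lapIntegrand, smul_smul, ← Complex.exp_add]

theorem intervalIntegrable_of_lapIntegrand {s : ℂ} {f : ℝ → E} {t : ℝ} (ht : 0 ≤ t)
    (hf : IntegrableOn (lapIntegrand s f) (Ioi 0)) : IntervalIntegrable f volume 0 t :=
  (intervalIntegrable_iff_integrableOn_Icc_of_le ht).2 (integrableOn_Icc_of_lapIntegrand t hf)

theorem lapIntegrand_clm (a : E →L[ℂ] E) (s : ℂ) (f : ℝ → E) :
    (lapIntegrand s fun t => a (f t)) = fun t => a (lapIntegrand s f t) := by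
  ext1 t
  simp [lapIntegrand]

theorem lapIntegrand_add (s : ℂ) (f g : ℝ → E) :
    (lapIntegrand s fun t => f t + g t) = fun t => lapIntegrand s f t + lapIntegrand s g t := by
  ext1 t
  simp [lapIntegrand]

/-- The variation of constants formula for the solution of `ẋ = a x + h`, `x 0 = v`. -/
def mildSolution (a : E →L[ℂ] E) (v : E) (h : ℝ → E) (t : ℝ) : E :=
  NormedSpace.exp (t • a) v + ∫ τ in 0..t, NormedSpace.exp ((t - τ) • a) (h τ)

theorem mildSolution_zero (v : E) (h : ℝ → E) (t : ℝ) :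
    mildSolution 0 v h t = v + ∫ τ in 0..t, h τ := by
  simp [mildSolution]

variable [CompleteSpace E]

theorem laplace_mildSolution (a : E →L[ℂ] E) (v : E) {h : ℝ → E} {s : ℂ} (hs : ‖a‖ + 1 < s.re)
    (hh : IntegrableOn (lapIntegrand s h) (Ioi 0)) :
    IntegrableOn (lapIntegrand s (mildSolution a v h)) (Ioi 0) ∧
      s • (∫ t in Ioi 0, lapIntegrand s (mildSolution a v h) t) -
        a (∫ t in Ioi 0, lapIntegrand s (mildSolution a v h) t) =
          v + ∫ t in Ioi 0, lapIntegrand s h t := by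
  obtain ⟨hR, hRa⟩ := laplace_exp a hs
  obtain ⟨h1, h2⟩ := laplace_response (ContinuousLinearMap.id ℂ (E →L[ℂ] E)) hR hh
  simp only [ContinuousLinearMap.id_apply] at h1 h2
  have h3 : (lapIntegrand s fun t : ℝ => NormedSpace.exp (t • a) v) =
      fun t => (lapIntegrand s (fun t : ℝ => NormedSpace.exp (t • a)) t) v := by
    ext1 t
    simp [lapIntegrand]
  have h4 : IntegrableOn (lapIntegrand s fun t : ℝ => NormedSpace.exp (t • a) v) (Ioi 0) := by
    rw [h3]; exact hR.apply_continuousLinearMap v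
  have h5 : ∫ t in Ioi 0, lapIntegrand s (fun t : ℝ => NormedSpace.exp (t • a) v) t =
      (∫ t in Ioi 0, lapIntegrand s (fun t : ℝ => NormedSpace.exp (t • a)) t) v := by
    rw [h3, ContinuousLinearMap.integral_apply hR]
  have h6 := lapIntegrand_add s (fun t : ℝ => NormedSpace.exp (t • a) v)
    (fun t => ∫ τ in 0..t, NormedSpace.exp ((t - τ) • a) (h τ))
  have h7 : lapIntegrand s (mildSolution a v h) = _ := h6
  rw [h7]
  refine ⟨h4.add h1, ?_⟩
  rw [integral_add h4 h1, h2, h5, ← map_add]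
  set R := ∫ t in Ioi 0, lapIntegrand s (fun t : ℝ => NormedSpace.exp (t • a)) t
  have := congrArg (fun b : E →L[ℂ] E => b (v + ∫ t in Ioi 0, lapIntegrand s h t)) hRa
  simpa using this

end

/-- For an input with a Laplace transform, the variation of constants formula yields, up to a null
set, a continuous solution of the integral equation of `ẋ = a x + h`: both sides of the equation
have the same transform, so that no differentiation of `exp (t a)` under the integral is needed. -/
theorem exists_integral_solution {n : ℕ} (a : (Fin n → ℂ) →L[ℂ] (Fin n → ℂ)) (v : Fin n → ℂ)
    {h : ℝ → Fin n → ℂ} {σ : ℝ}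
    (hh : ∀ s : ℂ, σ < s.re → IntegrableOn (lapIntegrand s h) (Ioi 0)) :
    ∃ (ξ : ℝ → Fin n → ℂ) (σ' : ℝ),
      (∀ s : ℂ, σ' < s.re → IntegrableOn (lapIntegrand s ξ) (Ioi 0) ∧
        s • (∫ t in Ioi 0, lapIntegrand s ξ t) - a (∫ t in Ioi 0, lapIntegrand s ξ t) =
          v + ∫ t in Ioi 0, lapIntegrand s h t) ∧
      (∀ T, ContinuousOn ξ (Icc 0 T)) ∧
      ∀ t, 0 ≤ t → ξ t = v + ∫ τ in 0..t, (a (ξ τ) + h τ) := by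
  -- `x` solves the equation in transforms, and `ξ` is the integral of its right-hand side; the two
  -- transforms agree, so the right-hand sides of `x` and `ξ` agree almost everywhere.
  set σ' := max σ (‖a‖ + 1) with hσ'
  have hσ : ∀ {s : ℂ}, σ' < s.re → σ < s.re := fun hs => (le_max_left _ _).trans_lt hs
  have hσa : ∀ {s : ℂ}, σ' < s.re → ‖a‖ + 1 < s.re := fun hs => (le_max_right _ _).trans_lt hs
  have hσ0 : ∀ {s : ℂ}, σ' < s.re → ‖(0 : (Fin n → ℂ) →L[ℂ] (Fin n → ℂ))‖ + 1 < s.re := fun hs => by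
    have := hσa hs
    have := norm_nonneg a
    rw [norm_zero]; linarith
  set x := mildSolution a v h with hx
  set g : ℝ → Fin n → ℂ := fun t => a (x t) + h t with hg
  set ξ := mildSolution 0 v g with hξ
  have hxL : ∀ s : ℂ, σ' < s.re → _ := fun s hs => laplace_mildSolution a v (hσa hs) (hh s (hσ hs))
  have hgL : ∀ s : ℂ, σ' < s.re → IntegrableOn (lapIntegrand s g) (Ioi 0) ∧
      ∫ t in Ioi 0, lapIntegrand s g t =
        a (∫ t in Ioi 0, lapIntegrand s x t) + ∫ t in Ioi 0, lapIntegrand s h t := by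
    intro s hs
    have h1 : IntegrableOn (fun t => a (lapIntegrand s x t)) (Ioi 0) :=
      a.integrable_comp (hxL s hs).1
    rw [hg, lapIntegrand_add, lapIntegrand_clm]
    exact ⟨h1.add (hh s (hσ hs)), by
      rw [integral_add h1 (hh s (hσ hs)), a.integral_comp_comm (hxL s hs).1]⟩
  have hξL : ∀ s : ℂ, σ' < s.re → _ := fun s hs => laplace_mildSolution 0 v (hσ0 hs) (hgL s hs).1
  have heq : ∀ s : ℂ, σ' < s.re →
      ∫ t in Ioi 0, lapIntegrand s ξ t = ∫ t in Ioi 0, lapIntegrand s x t := by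
    intro s hs
    have hs0 : s ≠ 0 := by
      rintro rfl
      have := hσa hs
      have := norm_nonneg a
      simp only [Complex.zero_re] at *
      linarith
    have h1 := (hξL s hs).2
    rw [(hgL s hs).2, _root_.zero_apply, sub_zero, add_left_comm, ← (hxL s hs).2,
      add_sub_cancel] at h1
    exact smul_right_injective _ hs0 h1
  have hae : ξ =ᵐ[volume.restrict (Ioi 0)] x :=
    ae_eq_of_laplace_eq (fun s hs => (hξL s hs).1) (fun s hs => (hxL s hs).1) heq
  have hσ'' : σ' < ((σ' + 1 : ℝ) : ℂ).re := by simp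
  refine ⟨ξ, σ', fun s hs => ⟨(hξL s hs).1, ?_⟩, fun T => ?_, fun t ht => ?_⟩
  · rw [heq s hs, (hxL s hs).2]
  · have h1 : ξ = fun t => v + ∫ τ in 0..t, g τ := funext fun t => mildSolution_zero v g t
    rw [h1]
    rcases le_total 0 T with hT | hT
    · have h2 := intervalIntegral.continuousOn_primitive_interval (a := 0) (b := T) (μ := volume)
        (f := g) (by
          rw [uIcc_of_le hT]; exact integrableOn_Icc_of_lapIntegrand T (hgL _ hσ'').1)
      rw [uIcc_of_le hT] at h2
      exact continuousOn_const.add h2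
    · exact (subsingleton_Icc_of_ge hT).continuousOn _
  · rw [hξ, mildSolution_zero]
    congr 1
    refine intervalIntegral.integral_congr_ae ?_
    rw [uIoc_of_le ht]
    have := (ae_restrict_iff' measurableSet_Ioi).1 hae
    filter_upwards [this] with τ hτ hmem
    simp only [hg]
    rw [← hτ hmem.1]

/-! ### The state behind a trackable trajectory -/

/-- The componentwise real part, as a bounded real-linear map. -/
def reV (n : ℕ) : (Fin n → ℂ) →L[ℝ] (Fin n → ℝ) :=
  ContinuousLinearMap.pi fun i => Complex.reCLM.comp (ContinuousLinearMap.proj i)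

@[simp]
theorem reV_cV {n : ℕ} (v : Fin n → ℝ) : reV n (cV n v) = v := by
  ext i
  simp [reV]

theorem reV_mulVec {m n : ℕ} (M : Matrix (Fin m) (Fin n) ℝ) (z : Fin n → ℂ) :
    reV m ((cM M).mulVec z) = M.mulVec (reV n z) := by
  ext i
  simp [reV, cM, Matrix.mulVec, dotProduct]

theorem HasLaplace.integrableOn_Icc {n : ℕ} {σ : ℝ} {f : ℝ → Fin n → ℝ} (hf : HasLaplace σ f)
    (T : ℝ) : IntegrableOn f (Icc 0 T) := by
  have h := integrableOn_Icc_of_lapIntegrand T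
    (hf.integrableOn (s := ((σ + 1 : ℝ) : ℂ)) (by simp))
  simpa [IntegrableOn] using (reV n).integrable_comp h

/-- A trackable trajectory is the output of an absolutely continuous state driven by an integrable
input. -/
theorem IsTrackable.exists_state {n p q : ℕ} {T : ℝ} {A : Matrix (Fin n) (Fin n) ℝ}
    {B : Matrix (Fin n) (Fin p) ℝ} {C : Matrix (Fin q) (Fin n) ℝ} {x₀ : Fin n → ℝ}
    {w : ℝ → Fin n → ℝ} {yd : ℝ → Fin q → ℝ} (h : IsTrackable T A B C x₀ w yd) (hT : 0 < T)
    (hyd : ContinuousOn yd (Icc 0 T)) :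
    ∃ (ud : ℝ → Fin p → ℝ) (ξ : ℝ → Fin n → ℝ), IntegrableOn ud (Icc 0 T) ∧
      ContinuousOn ξ (Icc 0 T) ∧
      (∀ t ∈ Icc 0 T, ξ t = x₀ + ∫ τ in 0..t, (A.mulVec (ξ τ) + B.mulVec (ud τ) + w τ)) ∧
      ∀ t ∈ Icc 0 T, C.mulVec (ξ t) = yd t := by
  obtain ⟨ud, y', w', σ, hy', hw', hLu, hLy, hLw, heq⟩ := h
  obtain ⟨σ₁, hσ₁⟩ := exists_isUnit_smul_one_sub (cM A)
  set f : ℝ → Fin n → ℝ := fun t => B.mulVec (ud t) + w' t with hf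
  have hBu := hLu.laplace_mulVec B
  have hsplit : ∀ s : ℂ, (lapIntegrand s fun t => cV n (f t)) =
      fun t => lapIntegrand s (fun t => cV n (B.mulVec (ud t))) t +
        lapIntegrand s (fun t => cV n (w' t)) t := fun s => by
    rw [← lapIntegrand_add]; simp only [hf, map_add]
  have hLf : ∀ s : ℂ, σ < s.re → IntegrableOn (lapIntegrand s fun t => cV n (f t)) (Ioi 0) := by
    intro s hs
    rw [hsplit]
    exact (hBu.1.integrableOn hs).add (hLw.integrableOn hs)
  have hF : ∀ s : ℂ, σ < s.re → ∫ t in Ioi 0, lapIntegrand s (fun t => cV n (f t)) t =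
      (cM B).mulVec (laplace ud s) + laplace w' s := by
    intro s hs
    rw [hsplit, integral_add (hBu.1.integrableOn hs) (hLw.integrableOn hs),
      ← hBu.1.laplace_eq hs, hBu.2 s hs, ← hLw.laplace_eq hs]
  obtain ⟨ζ, σ₂, hζL, hζc, hζ⟩ :=
    exists_integral_solution (mulVecL (cM A)) (cV n x₀) hLf
  -- The output of `ζ` and the extension of `yd` have the same transform.
  have hCζ : ∀ s, (lapIntegrand s fun t => (cM C).mulVec (ζ t)) =
      fun t => mulVecL (cM C) (lapIntegrand s ζ t) := fun s => by
    ext1 t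
    rw [lapIntegrand, lapIntegrand, map_smul, mulVecL_apply]
  have hae : (fun t => (cM C).mulVec (ζ t)) =ᵐ[volume.restrict (Ioi 0)] fun t => cV q (y' t) := by
    have h1 : ∀ {s : ℂ}, max (max σ σ₁) σ₂ < s.re → σ < s.re ∧ σ₁ < s.re ∧ σ₂ < s.re := by
      intro s hs
      rw [max_lt_iff, max_lt_iff] at hs
      exact ⟨hs.1.1, hs.1.2, hs.2⟩
    refine ae_eq_of_laplace_eq (σ := max (max σ σ₁) σ₂) (fun s hs => ?_)
      (fun s hs => hLy.integrableOn (h1 hs).1) fun s hs => ?_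
    · rw [hCζ]
      exact (mulVecL (cM C)).integrable_comp (hζL s (h1 hs).2.2).1
    · have h2 := hζL s (h1 hs).2.2
      rw [hCζ, (mulVecL (cM C)).integral_comp_comm h2.1, ← hLy.laplace_eq (h1 hs).1,
        transfer_eq_iff.1 (heq s (h1 hs).1), mulVecL_apply]
      refine (outputResolvent_mulVec (hσ₁ s (h1 hs).2.1) ?_).symm
      rw [← mulVecL_apply (cM A), h2.2, hF s (h1 hs).1, add_comm]
  have hout : EqOn (fun t => (cM C).mulVec (ζ t)) (fun t => cV q (yd t)) (Icc 0 T) := by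
    refine Measure.eqOn_Icc_of_ae_eq (μ := volume) hT.ne ?_
      ((mulVecL (cM C)).continuous.comp_continuousOn (hζc T))
      ((cV q).continuous.comp_continuousOn hyd)
    rw [Measure.restrict_congr_set Ioc_ae_eq_Icc.symm]
    have h1 := ae_restrict_of_ae_restrict_of_subset 
      (fun _ ht => ht.1 : Ioc 0 T ⊆ Ioi 0) hae
    filter_upwards [h1, ae_restrict_mem measurableSet_Ioc] with t ht hmem
    rw [ht, hy' (Ioc_subset_Icc_self hmem)]
  refine ⟨ud, fun t => reV n (ζ t), hLu.integrableOn_Icc T,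
    (reV n).continuous.comp_continuousOn (hζc T), fun t ht => ?_, fun t ht => ?_⟩
  · have hint : IntervalIntegrable (fun τ => mulVecL (cM A) (ζ τ) + cV n (f τ)) volume 0 t := by
      refine IntervalIntegrable.add ?_ (intervalIntegrable_of_lapIntegrand ht.1
        (hLf ((σ + 1 : ℝ) : ℂ) (by simp)))
      refine ContinuousOn.intervalIntegrable ?_
      rw [uIcc_of_le ht.1]
      exact (mulVecL (cM A)).continuous.comp_continuousOn (hζc t)
    simp only
    rw [hζ t ht.1, map_add, reV_cV, ← ContinuousLinearMap.intervalIntegral_comp_comm _ hint]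
    congr 1
    refine intervalIntegral.integral_congr fun τ hτ => ?_
    rw [uIcc_of_le ht.1] at hτ
    simp only [map_add, mulVecL_apply, reV_mulVec, reV_cV, hf,
      hw' (⟨hτ.1, hτ.2.trans ht.2⟩ : τ ∈ Icc 0 T), add_assoc]
  · simp only
    rw [← reV_mulVec, ← reV_cV (yd t)]
    exact congrArg (reV q) (hout ht)

end

/-! ### A continuous input behind a trackable trajectory -/

theorem eq_zero_of_mulVec_eq_self {p : ℕ} {N : Matrix (Fin p) (Fin p) ℝ} (h : specRad N < 1)
    {v : Fin p → ℝ} (hv : N.mulVec v = v) : v = 0 := by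
  obtain ⟨c, r, hr0, hr, hc⟩ := exists_norm_pow_le h
  have hfix : ∀ k : ℕ, (mulVecL N ^ k) v = v := by
    intro k
    induction k with
    | zero => simp
    | succ k ih => rw [pow_succ, mul_apply_eq_comp, mulVecL_apply, hv, ih]
  have hle : ∀ k : ℕ, ‖v‖ ≤ c * r ^ k * ‖v‖ := fun k => by
    have h1 := (mulVecL N ^ k).le_of_opNorm_le (hc k) v
    rwa [hfix k] at h1
  have h0 : Tendsto (fun k : ℕ => c * r ^ k * ‖v‖) atTop (𝓝 0) := by
    simpa using ((tendsto_pow_atTop_nhds_zero_of_lt_one hr0 hr).const_mul c).mul_const ‖v‖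
  exact norm_le_zero_iff.1 (ge_of_tendsto' h0 hle)

/-- If `1 - Υ M` is a contraction in the sense of the spectral radius, then `M` has a left
inverse, because a kernel vector of `Υ M` would be fixed by `1 - Υ M`. -/
theorem exists_left_inverse {p q : ℕ} {M : Matrix (Fin q) (Fin p) ℝ}
    {Υ : Matrix (Fin p) (Fin q) ℝ} (h : specRad (1 - Υ * M) < 1) :
    ∃ P : Matrix (Fin p) (Fin q) ℝ, P * M = 1 := by
  have hdet : (Υ * M).det ≠ 0 := by
    intro hdet
    obtain ⟨v, hv, hMv⟩ := Matrix.exists_mulVec_eq_zero_iff.2 hdet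
    refine hv (eq_zero_of_mulVec_eq_self h ?_)
    rw [Matrix.sub_mulVec, hMv, Matrix.one_mulVec, sub_zero]
  exact ⟨(Υ * M)⁻¹ * Υ, by
    rw [Matrix.mul_assoc, Matrix.nonsing_inv_mul _ (isUnit_iff_ne_zero.2 hdet)]⟩

/-- If `C B` has a left inverse `P`, then the input behind a trackable `C¹` trajectory is almost
everywhere equal to the continuous function `P (ẏd - C (A ξ + w))`, so the state is classical. -/
theorem IsTrackable.exists_isState {n p q : ℕ} {T : ℝ} {A : Matrix (Fin n) (Fin n) ℝ}
    {B : Matrix (Fin n) (Fin p) ℝ} {C : Matrix (Fin q) (Fin n) ℝ} {x₀ : Fin n → ℝ}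
    {w : ℝ → Fin n → ℝ} {yd : ℝ → Fin q → ℝ} {P : Matrix (Fin p) (Fin q) ℝ}
    (h : IsTrackable T A B C x₀ w yd) (hT : 0 < T) (hw : ContinuousOn w (Icc 0 T))
    (hyd : ContDiffOn ℝ 1 yd (Icc 0 T)) (hP : P * (C * B) = 1) :
    ∃ (v : ℝ → Fin p → ℝ) (ξ : ℝ → Fin n → ℝ), ContinuousOn v (Icc 0 T) ∧
      IsState T A B x₀ w v ξ ∧ ∀ t ∈ Icc 0 T, C.mulVec (ξ t) = yd t := by
  obtain ⟨ud, ξ, hud, hξc, hξ, hCξ⟩ := h.exists_state hT hyd.continuousOn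
  have hyd' : ContinuousOn (derivWithin yd (Icc 0 T)) (Icc 0 T) :=
    hyd.continuousOn_derivWithin (uniqueDiffOn_Icc hT) le_rfl
  set v : ℝ → Fin p → ℝ := fun t =>
    P.mulVec (derivWithin yd (Icc 0 T) t - C.mulVec (A.mulVec (ξ t) + w t)) with hv
  have hvc : ContinuousOn v (Icc 0 T) :=
    continuousOn_mulVec (hyd'.sub (continuousOn_mulVec
      ((continuousOn_mulVec hξc A).add hw) C)) P
  have hint : IntervalIntegrable (fun τ => A.mulVec (ξ τ) + B.mulVec (ud τ) + w τ) volume 0 T := by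
    rw [intervalIntegrable_iff_integrableOn_Icc_of_le hT.le]
    exact ((continuousOn_mulVec hξc A).integrableOn_Icc.add
      ((mulVecL B).integrable_comp hud)).add hw.integrableOn_Icc
  have hae : ∀ᵐ t, t ∈ Icc 0 T → ud t = v t := by
    have h0 : ∀ᵐ t : ℝ, t ≠ 0 := Measure.ae_ne volume 0
    have h1 : ∀ᵐ t : ℝ, t ≠ T := Measure.ae_ne volume T
    filter_upwards [hint.ae_hasDerivAt_integral, h0, h1] with t ht ht0 htT hmem
    have hmem' : t ∈ Ioo 0 T := ⟨lt_of_le_of_ne hmem.1 (Ne.symm ht0), lt_of_le_of_ne hmem.2 htT⟩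
    have hd := ht (by rwa [uIcc_of_le hT.le]) 0 left_mem_uIcc
    have hdξ : HasDerivWithinAt ξ (A.mulVec (ξ t) + B.mulVec (ud t) + w t) (Icc 0 T) t :=
      (hd.const_add x₀).hasDerivWithinAt.congr hξ (hξ t hmem)
    have hdy : HasDerivWithinAt yd (C.mulVec (A.mulVec (ξ t) + B.mulVec (ud t) + w t))
        (Icc 0 T) t :=
      ((mulVecL C).hasFDerivAt.comp_hasDerivWithinAt t hdξ).congr
        (fun s hs => (hCξ s hs).symm) (hCξ t hmem).symm
    have hsplit : A.mulVec (ξ t) + B.mulVec (ud t) + w t =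
        (A.mulVec (ξ t) + w t) + B.mulVec (ud t) := by abel
    rw [hv]
    simp only
    rw [hdy.derivWithin (uniqueDiffOn_Icc hT t hmem), hsplit, Matrix.mulVec_add C _ (B.mulVec _),
      add_sub_cancel_left, Matrix.mulVec_mulVec, Matrix.mulVec_mulVec, Matrix.mul_assoc, hP,
      Matrix.one_mulVec]
  refine ⟨v, ξ, hvc, isState_of_eq_add_integral hT.le hw hvc hξc fun t ht => ?_, hCξ⟩
  rw [hξ t ht]
  congr 1
  refine intervalIntegral.integral_congr_ae ?_
  filter_upwards [hae] with τ hτ hmem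
  rw [uIoc_of_le ht.1] at hmem
  rw [hτ ⟨hmem.1.le, hmem.2.trans ht.2⟩]

/-! ### The iteration -/

section Iteration

variable {n p q : ℕ} {T : ℝ} {A : Matrix (Fin n) (Fin n) ℝ} {B : Matrix (Fin n) (Fin p) ℝ}
  {C : Matrix (Fin q) (Fin n) ℝ} {Υ : Matrix (Fin p) (Fin q) ℝ} {x₀ : Fin n → ℝ}
  {w : ℝ → Fin n → ℝ} {yd : ℝ → Fin q → ℝ} {u : ℕ → ℝ → Fin p → ℝ} {x : ℕ → ℝ → Fin n → ℝ}

theorem IsState.hasDerivWithinAt_sub {u₁ u₂ : ℝ → Fin p → ℝ} {x₁ x₂ : ℝ → Fin n → ℝ}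
    (h₁ : IsState T A B x₀ w u₁ x₁) (h₂ : IsState T A B x₀ w u₂ x₂) {t : ℝ}
    (ht : t ∈ Icc 0 T) :
    HasDerivWithinAt (fun t => x₁ t - x₂ t)
      (mulVecL A (x₁ t - x₂ t) + mulVecL B (u₁ t - u₂ t)) (Icc 0 T) t := by
  convert! (h₁.2 t ht).sub (h₂.2 t ht) using 1
  simp only [mulVecL_apply, Matrix.mulVec_sub]
  abel

/-- The derivative of the tracking error belonging to the input `u` and the state `x`. -/
noncomputable def errorDeriv (T : ℝ) (A : Matrix (Fin n) (Fin n) ℝ) (B : Matrix (Fin n) (Fin p) ℝ)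
    (C : Matrix (Fin q) (Fin n) ℝ) (w : ℝ → Fin n → ℝ) (yd : ℝ → Fin q → ℝ) (u : ℝ → Fin p → ℝ)
    (x : ℝ → Fin n → ℝ) (t : ℝ) : Fin q → ℝ :=
  derivWithin yd (Icc 0 T) t - C.mulVec (A.mulVec (x t) + B.mulVec (u t) + w t)

theorem IsState.hasDerivWithinAt_error {u : ℝ → Fin p → ℝ} {x : ℝ → Fin n → ℝ}
    (hx : IsState T A B x₀ w u x) (hyd : ContDiffOn ℝ 1 yd (Icc 0 T)) {t : ℝ}
    (ht : t ∈ Icc 0 T) :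
    HasDerivWithinAt (fun τ => yd τ - output C x τ) (errorDeriv T A B C w yd u x t) (Icc 0 T) t :=
  ((hyd.differentiableOn one_ne_zero) t ht).hasDerivWithinAt.sub
    ((mulVecL C).hasFDerivAt.comp_hasDerivWithinAt t (hx.2 t ht))

theorem continuousOn_errorDeriv {u : ℝ → Fin p → ℝ} {x : ℝ → Fin n → ℝ} (hT : 0 < T)
    (hw : ContinuousOn w (Icc 0 T)) (hyd : ContDiffOn ℝ 1 yd (Icc 0 T))
    (hu : ContinuousOn u (Icc 0 T)) (hx : IsState T A B x₀ w u x) :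
    ContinuousOn (errorDeriv T A B C w yd u x) (Icc 0 T) :=
  (hyd.continuousOn_derivWithin (uniqueDiffOn_Icc hT) le_rfl).sub
    (continuousOn_mulVec (continuousOn_rhs hw hu hx.continuousOn) C)

theorem IsDTypeUpdate.eq_add (hu : IsDTypeUpdate T Υ yd u fun k => output C (x k)) (hT : 0 < T)
    (hyd : ContDiffOn ℝ 1 yd (Icc 0 T)) (hx : ∀ k, IsState T A B x₀ w (u k) (x k)) (k : ℕ) {t : ℝ}
    (ht : t ∈ Icc 0 T) :
    u (k + 1) t = u k t + Υ.mulVec (errorDeriv T A B C w yd (u k) (x k) t) := by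
  rw [hu k t ht, ((hx k).hasDerivWithinAt_error hyd ht).derivWithin (uniqueDiffOn_Icc hT t ht)]

theorem IsDTypeUpdate.continuousOn (hu : IsDTypeUpdate T Υ yd u fun k => output C (x k))
    (hT : 0 < T) (hw : ContinuousOn w (Icc 0 T)) (hyd : ContDiffOn ℝ 1 yd (Icc 0 T))
    (hx : ∀ k, IsState T A B x₀ w (u k) (x k)) (hu₀ : ContinuousOn (u 0) (Icc 0 T)) (k : ℕ) :
    ContinuousOn (u k) (Icc 0 T) := by
  induction k with
  | zero => exact hu₀
  | succ k ih =>
    exact (ih.add (continuousOn_mulVec (continuousOn_errorDeriv hT hw hyd ih (hx k)) Υ)).congr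
      fun t ht => hu.eq_add hT hyd hx k ht

theorem errorDeriv_sub {u₁ u₂ : ℝ → Fin p → ℝ} {x₁ x₂ : ℝ → Fin n → ℝ} (t : ℝ) :
    errorDeriv T A B C w yd u₁ x₁ t - errorDeriv T A B C w yd u₂ x₂ t =
      -((C * B).mulVec (u₁ t - u₂ t)) - (C * A).mulVec (x₁ t - x₂ t) := by
  simp only [errorDeriv, Matrix.mulVec_add, Matrix.mulVec_sub, ← Matrix.mulVec_mulVec]
  abel

/-- Under `ρ (1 - Υ C B) < 1`, two sequences of inputs whose differences obey the updating law
approach each other geometrically, and so do their states. -/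
theorem geometric_of_specRad_input {u' : ℕ → ℝ → Fin p → ℝ} {x' : ℕ → ℝ → Fin n → ℝ}
    (hρ : specRad (1 - Υ * (C * B)) < 1)
    (hx : ∀ k, IsState T A B x₀ w (u k) (x k)) (hx' : ∀ k, IsState T A B x₀ w (u' k) (x' k))
    (hc : ContinuousOn (fun t => u' 0 t - u 0 t) (Icc 0 T))
    (hd : ∀ k, ∀ t ∈ Icc 0 T, u' (k + 1) t - u (k + 1) t = u' k t - u k t +
      Υ.mulVec (errorDeriv T A B C w yd (u' k) (x' k) t -
        errorDeriv T A B C w yd (u k) (x k) t)) :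
    ∃ K ρ : ℝ, 0 ≤ ρ ∧ ρ < 1 ∧ ∀ k, ∀ t ∈ Icc 0 T,
      ‖u' k t - u k t‖ ≤ K * ρ ^ k ∧ ‖x' k t - x k t‖ ≤ K * ρ ^ k := by
  obtain ⟨c, r, hr0, hr, hcr⟩ := exists_norm_pow_le hρ
  obtain ⟨D, hD⟩ := isCompact_Icc.exists_bound_of_continuousOn hc
  refine exists_geometric_bound (N := mulVecL (-(Υ * (C * A)))) (A := mulVecL A) (G := mulVecL B)
    (d := fun k t => u' k t - u k t) (z := fun k t => x' k t - x k t) hr0 hr hcr hD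
    (fun k t ht => ?_) (fun k => by rw [(hx k).1, (hx' k).1, sub_self])
    (fun k t ht => (hx' k).hasDerivWithinAt_sub (hx k) ht)
  rw [hd k t ht, errorDeriv_sub]
  simp only [mulVecL_apply, Matrix.sub_mulVec, Matrix.one_mulVec, Matrix.neg_mulVec,
    ← Matrix.mulVec_mulVec, Matrix.mulVec_sub, Matrix.mulVec_neg]
  abel

/-- Under `ρ (1 - C B Υ) < 1`, the derivatives of the tracking errors and the increments of the
states decay geometrically. -/
theorem IsDTypeUpdate.geometric_of_specRad_output
    (hu : IsDTypeUpdate T Υ yd u fun k => output C (x k)) (hT : 0 < T)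
    (hw : ContinuousOn w (Icc 0 T)) (hyd : ContDiffOn ℝ 1 yd (Icc 0 T))
    (hx : ∀ k, IsState T A B x₀ w (u k) (x k)) (hu₀ : ContinuousOn (u 0) (Icc 0 T))
    (hρ : specRad (1 - C * B * Υ) < 1) :
    ∃ K ρ : ℝ, 0 ≤ ρ ∧ ρ < 1 ∧ ∀ k, ∀ t ∈ Icc 0 T,
      ‖errorDeriv T A B C w yd (u k) (x k) t‖ ≤ K * ρ ^ k ∧
        ‖x (k + 1) t - x k t‖ ≤ K * ρ ^ k := by
  obtain ⟨c, r, hr0, hr, hcr⟩ := exists_norm_pow_le hρ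
  obtain ⟨D, hD⟩ := isCompact_Icc.exists_bound_of_continuousOn
    (continuousOn_errorDeriv (C := C) hT hw hyd hu₀ (hx 0))
  have hinc : ∀ k, ∀ t ∈ Icc 0 T, u (k + 1) t - u k t =
      Υ.mulVec (errorDeriv T A B C w yd (u k) (x k) t) := fun k t ht => by
    rw [hu.eq_add hT hyd hx k ht, add_sub_cancel_left]
  refine exists_geometric_bound (N := mulVecL (-(C * A))) (A := mulVecL A) (G := mulVecL (B * Υ))
    (d := fun k t => errorDeriv T A B C w yd (u k) (x k) t) (z := fun k t => x (k + 1) t - x k t)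
    hr0 hr hcr hD (fun k t ht => ?_) (fun k => by rw [(hx k).1, (hx (k + 1)).1, sub_self])
    (fun k t ht => ?_)
  · rw [← sub_add_cancel (errorDeriv T A B C w yd (u (k + 1)) (x (k + 1)) t)
      (errorDeriv T A B C w yd (u k) (x k) t), errorDeriv_sub, hinc k t ht]
    simp only [mulVecL_apply, Matrix.sub_mulVec, Matrix.one_mulVec, Matrix.neg_mulVec,
      ← Matrix.mulVec_mulVec]
    abel
  · have h := (hx (k + 1)).hasDerivWithinAt_sub (hx k) ht
    rwa [hinc k t ht, mulVecL_apply B, Matrix.mulVec_mulVec, ← mulVecL_apply (B * Υ)] at h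

/-- If the inputs converge uniformly together with the states, perfect tracking means that the
limit input produces `yd`, so that `yd` is trackable. -/
theorem isTrackable_of_tendsto {u' : ℝ → Fin p → ℝ} {x' : ℝ → Fin n → ℝ} (hT : 0 ≤ T)
    (hw : ContinuousOn w (Icc 0 T)) (huc : ∀ k, ContinuousOn (u k) (Icc 0 T))
    (hx : ∀ k, IsState T A B x₀ w (u k) (x k)) (hu' : TendstoUniformlyOn u u' atTop (Icc 0 T))
    (hx' : TendstoUniformlyOn x x' atTop (Icc 0 T))
    (h : ∀ t ∈ Icc 0 T, Tendsto (fun k => output C (x k) t) atTop (𝓝 (yd t))) :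
    IsTrackable T A B C x₀ w yd := by
  refine (isState_of_tendstoUniformlyOn hT hw huc hx hu' hx').isTrackable hT hw
    (hu'.continuousOn (Frequently.of_forall huc)) fun t ht => ?_
  exact tendsto_nhds_unique
    (((mulVecL C).continuous.tendsto (x' t)).comp (hx'.tendsto_at ht)) (h t ht)

theorem IsDTypeUpdate.tendsto_of_specRad_input
    (hu : IsDTypeUpdate T Υ yd u fun k => output C (x k)) (hT : 0 < T)
    (hw : ContinuousOn w (Icc 0 T)) (hyd : ContDiffOn ℝ 1 yd (Icc 0 T))
    (hx : ∀ k, IsState T A B x₀ w (u k) (x k)) (hu₀ : ContinuousOn (u 0) (Icc 0 T))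
    (hρ : specRad (1 - Υ * (C * B)) < 1) (h : IsTrackable T A B C x₀ w yd) {t : ℝ}
    (ht : t ∈ Icc 0 T) : Tendsto (fun k => output C (x k) t) atTop (𝓝 (yd t)) := by
  obtain ⟨P, hP⟩ := exists_left_inverse hρ
  obtain ⟨v, ξ, hvc, hξ, hCξ⟩ := h.exists_isState hT hw hyd hP
  -- The input `v` is a fixed point of the updating law, as its tracking error vanishes.
  have hzero : ∀ t ∈ Icc 0 T, errorDeriv T A B C w yd v ξ t = 0 := by
    intro t ht
    rw [← (hξ.hasDerivWithinAt_error hyd ht).derivWithin (uniqueDiffOn_Icc hT t ht)]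
    have h0 : HasDerivWithinAt (fun τ => yd τ - output C ξ τ) 0 (Icc 0 T) t :=
      (hasDerivWithinAt_const t (Icc 0 T) (0 : Fin q → ℝ)).congr
        (fun s hs => sub_eq_zero.2 (hCξ s hs).symm) (sub_eq_zero.2 (hCξ t ht).symm)
    exact h0.derivWithin (uniqueDiffOn_Icc hT t ht)
  obtain ⟨K, ρ, hρ0, hρ1, hK⟩ := geometric_of_specRad_input (yd := yd) (u' := fun _ => v)
    (x' := fun _ => ξ) hρ hx (fun _ => hξ) (hvc.sub hu₀) fun k t ht => by
      rw [hu.eq_add hT hyd hx k ht, hzero t ht, zero_sub, Matrix.mulVec_neg]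
      abel
  have hlim : Tendsto (fun k => x k t) atTop (𝓝 (ξ t)) :=
    tendsto_of_geometric_bound hρ0 hρ1 fun k => by
      rw [norm_sub_rev]; exact (hK k t ht).2
  rw [← hCξ t ht]
  exact ((mulVecL C).continuous.tendsto (ξ t)).comp hlim

theorem IsDTypeUpdate.tendsto_of_specRad_output
    (hu : IsDTypeUpdate T Υ yd u fun k => output C (x k)) (hT : 0 < T)
    (hw : ContinuousOn w (Icc 0 T)) (hyd : ContDiffOn ℝ 1 yd (Icc 0 T))
    (hx : ∀ k, IsState T A B x₀ w (u k) (x k)) (hu₀ : ContinuousOn (u 0) (Icc 0 T))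
    (hρ : specRad (1 - C * B * Υ) < 1) (h : IsTrackable T A B C x₀ w yd) {t : ℝ}
    (ht : t ∈ Icc 0 T) : Tendsto (fun k => output C (x k) t) atTop (𝓝 (yd t)) := by
  obtain ⟨K, ρ, hρ0, hρ1, hK⟩ := hu.geometric_of_specRad_output hT hw hyd hx hu₀ hρ
  -- Trackability is used only for the initial value of `yd`.
  have h0 : C.mulVec x₀ = yd 0 := by
    obtain ⟨ud, ξ, -, -, hξ, hCξ⟩ := h.exists_state hT hyd.continuousOn
    have h1 := hξ 0 ⟨le_rfl, hT.le⟩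
    rw [intervalIntegral.integral_same, add_zero] at h1
    rw [← h1, hCξ 0 ⟨le_rfl, hT.le⟩]
  refine tendsto_of_geometric_bound (K := K * (t - 0)) hρ0 hρ1 fun k => ?_
  have h1 := norm_image_sub_le_of_norm_deriv_le_segment' (f := fun τ => yd τ - output C (x k) τ)
    (fun s hs => (hx k).hasDerivWithinAt_error hyd hs)
    (fun s hs => (hK k s (Ico_subset_Icc_self hs)).1) t ht
  have h2 : yd 0 - output C (x k) 0 = 0 := by rw [output, (hx k).1, h0, sub_self]
  rw [h2, sub_zero] at h1
  rw [norm_sub_rev]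
  linarith

end Iteration

end ILC

theorem corollary4 {n p q : ℕ} (T : ℝ) (hT : 0 < T)
    (A : Matrix (Fin n) (Fin n) ℝ) (B : Matrix (Fin n) (Fin p) ℝ)
    (C : Matrix (Fin q) (Fin n) ℝ) (Υ : Matrix (Fin p) (Fin q) ℝ)
    (x₀ : Fin n → ℝ) (w : ℝ → Fin n → ℝ) (hw : ContinuousOn w (Icc 0 T))
    (yd : ℝ → Fin q → ℝ) (hyd : ContDiffOn ℝ 1 yd (Icc 0 T))
    (u : ℕ → ℝ → Fin p → ℝ) (x : ℕ → ℝ → Fin n → ℝ)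
    (hu₀ : ContinuousOn (u 0) (Icc 0 T))
    (hx : ∀ k, ILC.IsState T A B x₀ w (u k) (x k))
    (hu : ILC.IsDTypeUpdate T Υ yd u (fun k => ILC.output C (x k)))
    (hρ : (p ≤ q ∧ ILC.specRad (1 - Υ * (C * B)) < 1) ∨
      (q ≤ p ∧ ILC.specRad (1 - C * B * Υ) < 1)) :
    (∃ (uinf : ℝ → Fin p → ℝ) (yinf : ℝ → Fin q → ℝ),
      TendstoUniformlyOn u uinf atTop (Icc 0 T) ∧
      TendstoUniformlyOn (fun k => ILC.output C (x k)) yinf atTop (Icc 0 T)) ∧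
    (((∀ t ∈ Icc 0 T, Tendsto (fun k => ILC.output C (x k) t) atTop (𝓝 (yd t))) ∧
        ∀ k, ContinuousOn (u k) (Icc 0 T)) ↔
      ILC.IsTrackable T A B C x₀ w yd) := by
  have huc := hu.continuousOn hT hw hyd hx hu₀
  obtain ⟨⟨u', hu'⟩, ⟨x', hx'⟩⟩ : (∃ u', TendstoUniformlyOn u u' atTop (Icc 0 T)) ∧
      ∃ x', TendstoUniformlyOn x x' atTop (Icc 0 T) := by
    rcases hρ with ⟨-, hρ⟩ | ⟨-, hρ⟩
    · obtain ⟨K, ρ, hρ0, hρ1, hK⟩ := ILC.geometric_of_specRad_input (yd := yd)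
        (u' := fun k => u (k + 1)) (x' := fun k => x (k + 1)) hρ hx (fun k => hx (k + 1))
        ((huc 1).sub (huc 0)) fun k t ht => by
          rw [hu.eq_add hT hyd hx (k + 1) ht, Matrix.mulVec_sub]
          conv_lhs => rw [hu.eq_add hT hyd hx k ht]
          conv_rhs => rw [hu.eq_add hT hyd hx k ht]
          abel
      exact ⟨ILC.exists_tendstoUniformlyOn_of_geometric hρ0 hρ1 fun k t ht => (hK k t ht).1,
        ILC.exists_tendstoUniformlyOn_of_geometric hρ0 hρ1 fun k t ht => (hK k t ht).2⟩
    · obtain ⟨K, ρ, hρ0, hρ1, hK⟩ := hu.geometric_of_specRad_output hT hw hyd hx hu₀ hρ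
      refine ⟨ILC.exists_tendstoUniformlyOn_of_geometric (K := ‖ILC.mulVecL Υ‖ * K) hρ0 hρ1
        fun k t ht => ?_,
        ILC.exists_tendstoUniformlyOn_of_geometric hρ0 hρ1 fun k t ht => (hK k t ht).2⟩
      rw [hu.eq_add hT hyd hx k ht, add_sub_cancel_left, ← ILC.mulVecL_apply, mul_assoc]
      exact ((ILC.mulVecL Υ).le_opNorm _).trans
        (mul_le_mul_of_nonneg_left (hK k t ht).1 (norm_nonneg _))
  refine ⟨⟨u', fun t => C.mulVec (x' t), hu',
    (ILC.mulVecL C).uniformContinuous.comp_tendstoUniformlyOn hx'⟩, fun h => ?_, fun h => ?_⟩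
  · exact ILC.isTrackable_of_tendsto hT.le hw huc hx hu' hx' h.1
  · refine ⟨fun t ht => ?_, huc⟩
    rcases hρ with ⟨-, hρ⟩ | ⟨-, hρ⟩
    · exact hu.tendsto_of_specRad_input hT hw hyd hx hu₀ hρ h ht
    · exact hu.tendsto_of_specRad_output hT hw hyd hx hu₀ hρ h ht
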